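/- Let $(X,d,\mu)$ be a separable metric space with a Borel measure $\mu$. Write $B(x,r)$ for open balls and $V(x,r)=V_r(x)=\mu(B(x,r))$. Assume that $V(x,r)<\infty$ for all $x\in X$, $r>0$, and that there are $n>0$ and $C_0>0$ with $$V(x,\lambda r)\le C_0\lambda^n V(x,r)\qquad\text{for all } x\in X,\ r>0,\ \lambda\ge 1 .$$ For a set $E$ let $P_Ef=\chi_Ef$. For $1\le p<2$ put $\sigma_p=\frac1p-\frac12$, and for an operator $T$ given on $L^2(X,\mu)$ let $\|T\|_{p\to q}\in[0,\infty]$ be the least $c$ with $\|Tf\|_q\le c\|f\|_p$ for all $f\in L^2\cap L^p$. Let $1\le p<2$, $a>[n/2]+1$ (where $[\cdot]$ is the integer part) and $\tau>0$, and let $A$ be a bounded self-adjoint operator on the complex space $L^2(X,\mu)$ that satisfies condition $\mathrm{PVE}^a_{p,2}(\tau)$: there is a constant $C_1>0$ such that for all $x,y\in X$ $$\big\|P_{B(x,\tau)}V_\tau^{\sigma_p}AP_{B(y,\tau)}\big\|_{p\to2}<C_1\Big(1+\frac{d(x,y)}{\tau}\Big)^{-n-a},$$ where $V_\tau^{\sigma_p}$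 denotes multiplication by the function $z\mapsto V(z,\tau)^{\sigma_p}$. Then there is a constant $C>0$ such that for all $t\in\mathbb R$ $$\|e^{itA}A\|_{p\to p}\le C(1+|t|)^{n\sigma_p}.$$ -/

import Mathlib

open MeasureTheory Metric
open scoped ENNReal

noncomputable section

/-- `μ` is doubling with homogeneous dimension `n`: balls have finite measure and
`V(x, s r) ≤ C s ^ n V(x, r)` for all `x`, `r > 0`, `s ≥ 1`, where `V(x, r) = μ (B(x, r))`. -/
def IsDoublingWithDim {X : Type*} [MetricSpace X] [MeasurableSpace X]
    (μ : Measure X) (n : ℝ) : Prop :=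
  (∀ (x : X) (r : ℝ), μ (ball x r) < ∞) ∧
  ∃ C : ℝ, 0 < C ∧ ∀ (x : X) (r s : ℝ), 0 < r → 1 ≤ s →
    μ (ball x (s * r)) ≤ ENNReal.ofReal (C * s ^ n) * μ (ball x r)

/-- The norm `‖T‖_{p → q} ∈ [0, ∞]` of an operator `T` given on `L²`: the least `c` with
`‖T f‖_q ≤ c ‖f‖_p` for all `f ∈ L² ∩ L^p` (a dense subspace of `L^p` for `p < ∞`). -/
def opNormLp {X : Type*} [MeasurableSpace X] {μ : Measure X} (p q : ℝ≥0∞)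
    (T : Lp ℂ 2 μ → X → ℂ) : ℝ≥0∞ :=
  sInf {c : ℝ≥0∞ | ∀ f : Lp ℂ 2 μ, MemLp f p μ → eLpNorm (T f) q μ ≤ c * eLpNorm f p μ}

/-- `P_{B(y, r)} f = χ_{B(y, r)} f` as an element of `L²`. -/
def ballProj {X : Type*} [MetricSpace X] [MeasurableSpace X] [BorelSpace X] {μ : Measure X}
    (y : X) (r : ℝ) (f : Lp ℂ 2 μ) : Lp ℂ 2 μ :=
  ((Lp.memLp f).indicator (measurableSet_ball (x := y) (ε := r))).toLp

/-- The exponent `σ_p = 1/p - 1/2`. -/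
def sigmaExp (p : ℝ) : ℝ := 1 / p - 1 / 2

/-- The operator `P_{B(x, τ)} V_τ ^ σ A P_{B(y, τ)}`, where `V_τ(z) = μ (B(z, τ))`. -/
def offDiagPiece {X : Type*} [MetricSpace X] [MeasurableSpace X] [BorelSpace X] {μ : Measure X}
    (A : Lp ℂ 2 μ →L[ℂ] Lp ℂ 2 μ) (σ τ : ℝ) (x y : X) (f : Lp ℂ 2 μ) : X → ℂ :=
  (ball x τ).indicator fun z => ((μ.real (ball z τ) ^ σ : ℝ) : ℂ) * A (ballProj y τ f) z

/-- The polynomial off-diagonal condition `PVE^a_{p,2}(τ)` (relative to the dimension `n`). -/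
def PVE {X : Type*} [MetricSpace X] [MeasurableSpace X] [BorelSpace X] {μ : Measure X}
    (n a p τ : ℝ) (A : Lp ℂ 2 μ →L[ℂ] Lp ℂ 2 μ) : Prop :=
  ∃ C : ℝ, 0 < C ∧ ∀ x y : X,
    opNormLp (ENNReal.ofReal p) 2 (offDiagPiece A (sigmaExp p) τ x y)
      < ENNReal.ofReal (C * (1 + dist x y / τ) ^ (-n - a))

end

/-! Discretise at scale τ. A maximal τ-separated net yields a countable partition of X into cells `Q
i` contained in balls B(i, τ) of volume V_i, and L² splits into orthogonal blocks `P i`. By Hölder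
on each cell, ‖g‖_p is at most the block norm (∑ (V_i^σ ‖P_i g‖₂)^p)^(1/p), where σ = σ_p; by PVE
and the Schur test (`ENNReal.tsum_rpow_le_of_schur`), A maps L^p into the space with this norm. It
remains to bound e^{itA} on the block space by a multiple of (1 + |t|)^(nσ).

PVE and Hölder also give L² decay of order n + a between blocks, up to the factor (V_j / V_i)^σ,
which self-adjointness removes (`IsBlockDecomposition.norm_le_of_weighted`). Put T = 1 + |t| and k =
[n/2] + 1 < a. Commuting A with powers up to k of the weight 1 + ρ(·, j)/T keeps a summable kernel
and gains 1/T, which pays for integrating over a time of length at most T. Hence e^{itA} spreads a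
block only over net distances of order T (`exists_norm_weight_expGroup_le`).

As 2k > n, Cauchy–Schwarz turns this into a volume-weighted ℓ¹ bound of size T^(n/2)
(`exists_tsum_sqrt_mul_expGroup_le`). On ℓ² the group is unitary. Real interpolation
(`exists_sum_rpow_le_of_splitting`) gives T^(nσ) on the block space. -/

/-! ### Sums over discrete sets: polynomial growth, Jensen, Schur. -/

/-- If a quantity `c` over `δ < R` grows at most like `R ^ n`, then `∑ c (1 + δ) ^ (-s)` converges
for `s > n`. -/
theorem exists_tsum_mul_one_add_rpow_neg_le (n s : ℝ) (hn : 0 < n) (hs : n < s) :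
    ∃ C : ℝ, 0 < C ∧ ∀ {ι : Type*} (δ : ι → ℝ) (c : ι → ℝ≥0∞) (K : ℝ≥0∞), (∀ i, 0 ≤ δ i) →
      (∀ R : ℝ, 1 ≤ R → ∑' i, {i | δ i < R}.indicator c i ≤ K * ENNReal.ofReal (R ^ n)) →
      ∑' i, c i * ENNReal.ofReal ((1 + δ i) ^ (-s)) ≤ ENNReal.ofReal C * K := by
  have hq0 : (0 : ℝ) < 2 ^ (n - s) := by positivity
  have hq1 : (2 : ℝ) ^ (n - s) < 1 := Real.rpow_lt_one_of_one_lt_of_neg (by norm_num) (by linarith)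
  refine ⟨2 ^ n * (1 - 2 ^ (n - s))⁻¹, by have := sub_pos.2 hq1; positivity, ?_⟩
  intro ι δ c K hδ hR
  -- Dyadic shells: the index i is charged to the l with 2^l ≤ 1 + δ i < 2^(l+1).
  have key : ∀ i, c i * ENNReal.ofReal ((1 + δ i) ^ (-s)) ≤
      ∑' l : ℕ, ENNReal.ofReal (2 ^ (-s * l)) * {i | δ i < 2 ^ (l + 1)}.indicator c i := by
    intro i
    obtain ⟨l, hl1, hl2⟩ := exists_nat_pow_near (x := 1 + δ i) (y := 2)
      (by linarith [hδ i]) (by norm_num)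
    refine le_trans ?_ (ENNReal.le_tsum l)
    rw [Set.indicator_of_mem (by simp only [Set.mem_ofPred_eq]; linarith), mul_comm]
    gcongr
    rw [neg_mul, Real.rpow_neg (by linarith [hδ i]), Real.rpow_neg (by norm_num), mul_comm s,
      Real.rpow_mul (by norm_num), Real.rpow_natCast]
    exact inv_anti₀ (by positivity) (Real.rpow_le_rpow (by positivity) hl1 (by linarith))
  calc _ ≤ ∑' i, ∑' l : ℕ, ENNReal.ofReal (2 ^ (-s * l)) *
        {i | δ i < 2 ^ (l + 1)}.indicator c i := ENNReal.tsum_le_tsum key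
    _ = ∑' l : ℕ, ENNReal.ofReal (2 ^ (-s * l)) *
        ∑' i, {i | δ i < 2 ^ (l + 1)}.indicator c i := by
      rw [ENNReal.tsum_comm]; simp_rw [ENNReal.tsum_mul_left]
    _ ≤ ∑' l : ℕ, ENNReal.ofReal (2 ^ n * (2 ^ (n - s)) ^ l) * K := by
      refine ENNReal.tsum_le_tsum fun l => ?_
      refine (mul_le_mul_right (hR _ (one_le_pow₀ (by norm_num))) _).trans_eq ?_
      rw [mul_comm K, ← mul_assoc, ← ENNReal.ofReal_mul (by positivity)]
      congr 2
      rw [← Real.rpow_natCast 2 (l + 1), ← Real.rpow_mul (by norm_num),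
        ← Real.rpow_natCast (2 ^ (n - s)) l, ← Real.rpow_mul (by norm_num),
        ← Real.rpow_add (by norm_num), ← Real.rpow_add (by norm_num)]
      congr 1; push_cast; ring
    _ = _ := by
      rw [ENNReal.tsum_mul_right, ← ENNReal.ofReal_tsum_of_nonneg (fun l => by positivity)
        ((summable_geometric_of_lt_one hq0.le hq1).mul_left _), tsum_mul_left,
        tsum_geometric_of_lt_one hq0.le hq1]

/-- Hölder's inequality for sums of extended nonnegative reals. -/
theorem ENNReal.tsum_mul_le_Lp_mul_Lq {ι : Type*} {p q : ℝ} (hpq : p.HolderConjugate q)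
    (f g : ι → ℝ≥0∞) :
    ∑' j, f j * g j ≤ (∑' j, f j ^ p) ^ (1 / p) * (∑' j, g j ^ q) ^ (1 / q) := by
  let _ : MeasurableSpace ι := ⊤
  have h := ENNReal.lintegral_mul_le_Lp_mul_Lq (Measure.count : Measure ι) hpq (f := f) (g := g)
    (measurable_from_top.aemeasurable) (measurable_from_top.aemeasurable)
  simpa only [lintegral_count, Pi.mul_apply] using h

/-- Weighted Jensen inequality for sums of extended nonnegative reals. -/
theorem ENNReal.tsum_mul_rpow_le {ι : Type*} (p : ℝ) (hp : 1 ≤ p) (k c : ι → ℝ≥0∞) :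
    (∑' j, k j * c j) ^ p ≤ (∑' j, k j) ^ (p - 1) * ∑' j, k j * c j ^ p := by
  rcases hp.eq_or_lt with rfl | hp
  · simp
  have hpq : p.HolderConjugate (p / (p - 1)) := Real.HolderConjugate.conjExponent hp
  set q := p / (p - 1)
  have h := ENNReal.tsum_mul_le_Lp_mul_Lq hpq (fun j => k j ^ (1 / p) * c j)
    (fun j => k j ^ (1 / q))
  have e1 : ∀ j, k j ^ (1 / p) * c j * k j ^ (1 / q) = k j * c j := fun j => by
    rw [mul_right_comm, ← ENNReal.rpow_add_of_nonneg _ _ hpq.one_div_nonneg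
      hpq.symm.one_div_nonneg, hpq.one_div_add_one_div]
    simp
  have e2 : ∀ j, (k j ^ (1 / p) * c j) ^ p = k j * c j ^ p := fun j => by
    rw [ENNReal.mul_rpow_of_nonneg _ _ (by linarith), ← ENNReal.rpow_mul, one_div,
      inv_mul_cancel₀ (by linarith), ENNReal.rpow_one]
  have e3 : ∀ j, (k j ^ (1 / q)) ^ q = k j := fun j => by
    rw [← ENNReal.rpow_mul, one_div, inv_mul_cancel₀ hpq.symm.ne_zero, ENNReal.rpow_one]
  simp only [e1, e2, e3] at h
  calc _ ≤ _ := ENNReal.rpow_le_rpow h (by linarith : 0 ≤ p)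
    _ = _ := by
      rw [ENNReal.mul_rpow_of_nonneg _ _ (by linarith), ← ENNReal.rpow_mul, ← ENNReal.rpow_mul,
        one_div, inv_mul_cancel₀ (by linarith), ENNReal.rpow_one, mul_comm]
      congr 2
      simp only [q]; field_simp

/-- Schur test on `ℓ^p`. -/
theorem ENNReal.tsum_rpow_le_of_schur {ι : Type*} (p : ℝ) (hp : 1 ≤ p) (k : ι → ι → ℝ≥0∞)
    (K : ℝ≥0∞) (hrow : ∀ i, ∑' j, k i j ≤ K) (hcol : ∀ j, ∑' i, k i j ≤ K)
    (b c : ι → ℝ≥0∞) (hb : ∀ i, b i ≤ ∑' j, k i j * c j) :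
    ∑' i, b i ^ p ≤ K ^ p * ∑' j, c j ^ p := by
  have hp0 : 0 ≤ p - 1 := by linarith
  calc ∑' i, b i ^ p ≤ ∑' i, K ^ (p - 1) * ∑' j, k i j * c j ^ p := by
        refine ENNReal.tsum_le_tsum fun i => ?_
        refine (ENNReal.rpow_le_rpow (hb i) (by linarith)).trans
          ((ENNReal.tsum_mul_rpow_le p hp _ _).trans ?_)
        gcongr
        exact hrow i
    _ = K ^ (p - 1) * ∑' j, (∑' i, k i j) * c j ^ p := by
        rw [ENNReal.tsum_mul_left, ENNReal.tsum_comm]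
        simp_rw [ENNReal.tsum_mul_right]
    _ ≤ K ^ (p - 1) * ∑' j, K * c j ^ p := by
        gcongr with j
        exact hcol j
    _ = _ := by
        rw [ENNReal.tsum_mul_left, ← mul_assoc]
        congr 1
        nth_rewrite 2 [← ENNReal.rpow_one K]
        rw [← ENNReal.rpow_add_of_nonneg _ _ hp0 zero_le_one]
        simp

/-! ### Real interpolation between ℓ¹ and ℓ². -/

theorem integrableOn_indicator_Iio_rpow {p : ℝ} (hp : 1 < p) (G : ℝ) :
    IntegrableOn ((Set.Iio G).indicator fun r : ℝ => r ^ (p - 2)) (Set.Ioi 0) := by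
  rw [IntegrableOn, integrable_indicator_iff measurableSet_Iio, IntegrableOn,
    Measure.restrict_restrict measurableSet_Iio, Set.Iio_inter_Ioi]
  exact (intervalIntegral.intervalIntegrable_rpow' (a := 0) (b := G) (r := p - 2)
    (by linarith)).1.mono_set Set.Ioo_subset_Ioc_self

theorem integral_indicator_Iio_rpow {p : ℝ} (hp : 1 < p) {G : ℝ} (hG : 0 ≤ G) :
    ∫ r in Set.Ioi (0 : ℝ), (Set.Iio G).indicator (fun r => r ^ (p - 2)) r
      = G ^ (p - 1) / (p - 1) := by
  rw [setIntegral_indicator measurableSet_Iio, Set.Ioi_inter_Iio, ← integral_Ioc_eq_integral_Ioo,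
    ← intervalIntegral.integral_of_le hG, integral_rpow (Or.inl (by linarith)),
    Real.zero_rpow (by linarith)]
  ring_nf

theorem integrableOn_indicator_Ici_rpow {p : ℝ} (hp : p < 2) {G : ℝ} (hG : 0 < G) :
    IntegrableOn ((Set.Ici G).indicator fun r : ℝ => r ^ (p - 3)) (Set.Ioi 0) := by
  refine Integrable.integrableOn ?_
  rw [integrable_indicator_iff measurableSet_Ici, integrableOn_Ici_iff_integrableOn_Ioi]
  exact integrableOn_Ioi_rpow_of_lt (by linarith) hG

theorem integral_indicator_Ici_rpow {p : ℝ} (hp : p < 2) {G : ℝ} (hG : 0 < G) :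
    ∫ r in Set.Ioi (0 : ℝ), (Set.Ici G).indicator (fun r => r ^ (p - 3)) r
      = G ^ (p - 2) / (2 - p) := by
  rw [setIntegral_indicator measurableSet_Ici,
    Set.inter_eq_self_of_subset_right (Set.Ici_subset_Ioi.2 hG),
    integral_Ici_eq_integral_Ioi, integral_Ioi_rpow_of_lt (by linarith) hG]
  rw [show p - 3 + 1 = -(2 - p) by ring, neg_div_neg_eq, show -(2 - p) = p - 2 by ring]

/-- The numerical core of real interpolation between `ℓ¹` and `ℓ²`: if, for each splitting of the
data `g`, the quantity `G` is dominated by a sum of a part controlled in `ℓ¹` with constant `M`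
and a part controlled in `ℓ²` with constant `1`, then it is controlled in `ℓ^p` with
constant `M ^ (2 - p)`. -/
theorem exists_sum_rpow_le_of_splitting (p : ℝ) (hp1 : 1 ≤ p) (hp2 : p < 2) :
    ∃ C : ℝ, 0 < C ∧ ∀ {ι : Type*} (E F : Finset ι) (v G g : ι → ℝ) (M : ℝ), 0 < M →
      (∀ i, 0 < v i) → (∀ i, 0 ≤ G i) → (∀ i, 0 ≤ g i) →
      (∀ s : Set ι, ∃ a b : ι → ℝ, (∀ i, 0 ≤ a i) ∧ (∀ i, 0 ≤ b i) ∧ (∀ i, G i ≤ a i + b i) ∧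
        ∑ i ∈ E, v i * a i ≤ M * ∑ j ∈ F, s.indicator (fun j => v j * g j) j ∧
        ∑ i ∈ E, v i * b i ^ 2 ≤ ∑ j ∈ F, sᶜ.indicator (fun j => v j * g j ^ 2) j) →
      ∑ i ∈ E, v i * G i ^ p ≤ C * M ^ (2 - p) * ∑ j ∈ F, v j * g j ^ p := by
  rcases hp1.eq_or_lt with rfl | hp1
  -- For p = 1 the integral of r^(p-2) at 0 diverges; here all data go into the ℓ¹ part, which
  -- forces b = 0 on E.
  · refine ⟨1, one_pos, ?_⟩
    intro ι E F v G g M hM hv hG hg h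
    obtain ⟨a, b, ha, hb, hab, h1, h2⟩ := h Set.univ
    simp only [Set.compl_univ, Set.indicator_empty, Finset.sum_const_zero] at h2
    simp only [Set.indicator_univ] at h1
    have h3 : ∀ i ∈ E, v i * b i ^ 2 = 0 :=
      (Finset.sum_eq_zero_iff_of_nonneg fun i _ => mul_nonneg (hv i).le (sq_nonneg _)).1
        (h2.antisymm (Finset.sum_nonneg fun i _ => mul_nonneg (hv i).le (sq_nonneg _)))
    norm_num
    refine le_trans (Finset.sum_le_sum fun i hi => ?_) h1
    have : b i = 0 := by simpa [(hv i).ne'] using h3 i hi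
    have := hab i
    exact mul_le_mul_of_nonneg_left (by linarith) (hv i).le
  have hp3 : 0 < p - 1 := by linarith
  have hp4 : 0 < 2 - p := by linarith
  refine ⟨(p - 1) * (2 / (p - 1) + 4 / (2 - p)), by positivity, ?_⟩
  intro ι E F v G g M hM hv hG hg h
  -- zero data contribute nothing
  set F' := F.filter fun j => 0 < g j
  have hF' : ∀ φ : ι → ℝ, (∀ j, g j = 0 → φ j = 0) → ∑ j ∈ F, φ j = ∑ j ∈ F', φ j := by
    intro φ hφ
    rw [Finset.sum_filter_of_ne]
    intro j _ hj
    exact (hg j).lt_of_ne' fun h0 => hj (hφ j h0)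
  -- Layer-cake argument: at height r the data with g > rM go to the ℓ¹ part. If r < G ≤ a + b, then
  -- G ≤ 2a when b ≤ a, and otherwise G ≤ G²/r ≤ 4b²/r. After multiplication by r^(p-2) and
  -- integration in r, the threshold g/M makes both parts scale as M^(2-p) g^p.
  have pt : ∀ r ∈ Set.Ioi (0 : ℝ),
      ∑ i ∈ E, v i * G i * (Set.Iio (G i)).indicator (fun r => r ^ (p - 2)) r ≤
      ∑ j ∈ F', (2 * M * (v j * g j) * (Set.Iio (g j / M)).indicator (fun r => r ^ (p - 2)) r +
        4 * (v j * g j ^ 2) * (Set.Ici (g j / M)).indicator (fun r => r ^ (p - 3)) r) := by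
    intro r (hr : 0 < r)
    obtain ⟨a, b, ha, hb, hab, h1, h2⟩ := h {j | r < g j / M}
    rw [hF' _ (by intro j hj; simp [Set.indicator, hj])] at h1 h2
    have hr3 : r ^ (p - 3) = r ^ (p - 2) / r := by
      rw [show p - 3 = p - 2 - 1 by ring, Real.rpow_sub_one hr.ne']
    have hr2 : 0 ≤ r ^ (p - 2) := by positivity
    calc _ ≤ ∑ i ∈ E, (2 * r ^ (p - 2) * (v i * a i) + 4 * r ^ (p - 3) * (v i * b i ^ 2)) := by
          refine Finset.sum_le_sum fun i _ => ?_
          have hai := ha i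
          have hvi := (hv i).le
          have hbi := hb i
          by_cases hi : r < G i
          · rw [Set.indicator_of_mem (by exact hi), hr3]
            have : G i ≤ 2 * a i + 4 * (b i ^ 2 / r) := by
              rcases le_total (b i) (a i) with hba | hba
              · have : 0 ≤ 4 * (b i ^ 2 / r) := by positivity
                linarith [hab i]
              · have : G i ≤ 4 * (b i ^ 2 / r) := by
                  rw [← mul_div_assoc, le_div_iff₀ hr]
                  nlinarith [hab i, hG i]
                linarith
            calc v i * G i * r ^ (p - 2)
                ≤ v i * (2 * a i + 4 * (b i ^ 2 / r)) * r ^ (p - 2) := by gcongr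
              _ = _ := by ring
          · rw [Set.indicator_of_notMem (by exact hi), mul_zero]
            positivity
      _ = 2 * r ^ (p - 2) * ∑ i ∈ E, v i * a i + 4 * r ^ (p - 3) * ∑ i ∈ E, v i * b i ^ 2 := by
          rw [Finset.sum_add_distrib, Finset.mul_sum, Finset.mul_sum]
      _ ≤ 2 * r ^ (p - 2) * (M * ∑ j ∈ F', {j | r < g j / M}.indicator (fun j => v j * g j) j) +
          4 * r ^ (p - 3) * ∑ j ∈ F', {j | r < g j / M}ᶜ.indicator (fun j => v j * g j ^ 2) j := by
          gcongr
      _ = _ := by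
          rw [Finset.mul_sum, Finset.mul_sum, Finset.mul_sum, ← Finset.sum_add_distrib]
          refine Finset.sum_congr rfl fun j _ => ?_
          by_cases hj : r < g j / M
          · simp [Set.indicator, hj, not_le.2 hj]; ring
          · simp [Set.indicator, hj, not_lt.1 hj]; ring
  have hgM : ∀ j ∈ F', 0 < g j / M := fun j hj => div_pos (Finset.mem_filter.1 hj).2 hM
  have hi1 := fun x : ℝ => integrableOn_indicator_Iio_rpow hp1 x
  have hi2 : ∀ j ∈ F', _ := fun j hj => integrableOn_indicator_Ici_rpow hp2 (hgM j hj)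
  have key := setIntegral_mono_on
    (integrable_finsetSum _ fun i _ => (hi1 (G i)).const_mul _)
    (integrable_finsetSum _ fun j hj => ((hi1 (g j / M)).const_mul _).add
      ((hi2 j hj).const_mul _)) measurableSet_Ioi pt
  rw [integral_finsetSum _ fun i _ => (hi1 (G i)).const_mul _,
    integral_finsetSum _ fun j hj => ((hi1 (g j / M)).const_mul _).add
      ((hi2 j hj).const_mul _)] at key
  simp only [Pi.add_apply] at key
  have e1 : ∀ i ∈ E, ∫ r in Set.Ioi (0 : ℝ),
      v i * G i * (Set.Iio (G i)).indicator (fun r => r ^ (p - 2)) r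
        = v i * G i ^ p / (p - 1) := by
    intro i _
    rw [integral_const_mul, integral_indicator_Iio_rpow hp1 (hG i), mul_assoc, mul_div_assoc,
      ← mul_div_assoc, ← Real.rpow_one_add' (hG i) (by linarith)]
    ring_nf
  have e2 : ∀ j ∈ F', ∫ r in Set.Ioi (0 : ℝ),
      (2 * M * (v j * g j) * (Set.Iio (g j / M)).indicator (fun r => r ^ (p - 2)) r +
        4 * (v j * g j ^ 2) * (Set.Ici (g j / M)).indicator (fun r => r ^ (p - 3)) r)
        = (2 / (p - 1) + 4 / (2 - p)) * M ^ (2 - p) * (v j * g j ^ p) := by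
    intro j hj
    have hgj := (Finset.mem_filter.1 hj).2
    rw [integral_add ((hi1 (g j / M)).const_mul _) ((hi2 j hj).const_mul _), integral_const_mul,
      integral_const_mul, integral_indicator_Iio_rpow hp1 (hgM j hj).le,
      integral_indicator_Ici_rpow hp2 (hgM j hj), Real.div_rpow (hg j) hM.le,
      Real.div_rpow (hg j) hM.le, Real.rpow_sub_one hgj.ne', Real.rpow_sub_one hM.ne',
      Real.rpow_sub hgj, Real.rpow_sub hM, Real.rpow_sub hM]
    norm_num only [Real.rpow_ofNat]
    field_simp
  rw [Finset.sum_congr rfl e1, Finset.sum_congr rfl e2, ← Finset.mul_sum, ← Finset.sum_div,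
    div_le_iff₀ hp3] at key
  rw [hF' _ (by intro j hj; simp [hj, Real.zero_rpow (by linarith : p ≠ 0)])]
  linarith

/-! ### The unitary group and its commutator estimate. -/

section UnitaryGroup

variable {H : Type*} [NormedAddCommGroup H] [InnerProductSpace ℂ H] [CompleteSpace H]

/-- The unitary group `e^{itA}` of a bounded operator `A`. -/
noncomputable def expGroup (A : H →L[ℂ] H) (t : ℝ) : H →L[ℂ] H :=
  NormedSpace.exp ((Complex.I * (t : ℂ)) • A)

theorem expGroup_zero (A : H →L[ℂ] H) : expGroup A 0 = 1 := by
  simp [expGroup]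

theorem norm_expGroup_apply {A : H →L[ℂ] H} (hA : IsSelfAdjoint A) (t : ℝ) (x : H) :
    ‖expGroup A t x‖ = ‖x‖ := by
  have hs : IsSelfAdjoint ((t : ℂ) • A) := by
    refine IsSelfAdjoint.smul ?_ hA
    simp [IsSelfAdjoint]
  have h := (selfAdjoint.expUnitary ⟨_, hs⟩).2
  rw [selfAdjoint.expUnitary_coe] at h
  have e : expGroup A t = NormedSpace.exp (Complex.I • ((t : ℂ) • A)) := by
    rw [expGroup, mul_smul]
  rw [e]
  exact ContinuousLinearMap.norm_map_of_mem_unitary h x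

theorem expGroup_eq_exp_smul (A : H →L[ℂ] H) (s : ℝ) :
    expGroup A s = NormedSpace.exp ((s : ℂ) • (Complex.I • A)) := by
  rw [expGroup, smul_smul, mul_comm]

theorem commute_expGroup (A : H →L[ℂ] H) (t : ℝ) : Commute A (expGroup A t) :=
  ((Commute.refl A).smul_right _).exp_right

/-- Duhamel estimate for the growth of an observable along `e^{itA}`. -/
theorem norm_apply_expGroup_le {A : H →L[ℂ] H} (hA : IsSelfAdjoint A) (B : H →L[ℂ] H) (h : H)
    (T M : ℝ) (hM : ∀ s : ℝ, |s| ≤ T → ‖(B * A - A * B) (expGroup A s h)‖ ≤ M)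
    (t : ℝ) (ht : |t| ≤ T) : ‖B (expGroup A t h)‖ ≤ ‖B h‖ + M * |t| := by
  -- In the Heisenberg picture e^{-isA} B e^{isA}, the derivative sees B only through its commutator
  -- with A; the mean value inequality then suffices, because the outer factors are isometric.
  have hd : ∀ s : ℝ, HasDerivAt (fun s => (expGroup A (-s) * B * expGroup A s) h)
      (Complex.I • expGroup A (-s) ((B * A - A * B) (expGroup A s h))) s := by
    intro s
    let A' : H →L[ℂ] H := Complex.I • A
    have h0 : ∀ z : ℂ, HasDerivAt (fun z : ℂ => NormedSpace.exp (z • A'))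
        (A' * NormedSpace.exp (z • A')) z := hasDerivAt_exp_smul_const' A'
    have h1 : HasDerivAt (fun z : ℂ => NormedSpace.exp ((-z) • A'))
        ((-1 : ℂ) • (A' * NormedSpace.exp ((-(s : ℂ)) • A'))) s :=
      (h0 (-(s : ℂ))).scomp (s : ℂ) (hasDerivAt_neg (s : ℂ))
    have h2 := ((h1.mul_const B).mul (h0 s)).clm_apply (hasDerivAt_const (s : ℂ) h)
    have h3 := h2.scomp s (Complex.ofRealCLM.hasDerivAt (x := s))
    have e1 : NormedSpace.exp ((-(s : ℂ)) • A') = expGroup A (-s) := by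
      rw [expGroup_eq_exp_smul]; simp [A']
    have e2 : NormedSpace.exp ((s : ℂ) • A') = expGroup A s := (expGroup_eq_exp_smul A s).symm
    rw [e1, e2] at h3
    convert h3 using 1
    · ext r
      simp [expGroup_eq_exp_smul, A']
    · have hc := (commute_expGroup A (-s)).eq
      simp only [A', smul_mul_assoc, hc]
      simp [smul_sub]
      abel
  have key := (convex_Icc (-T) T).norm_image_sub_le_of_norm_hasDerivWithin_le (C := M)
    (fun s _ => (hd s).hasDerivWithinAt)
    (fun s hs => by
      rw [norm_smul, Complex.norm_I, one_mul, norm_expGroup_apply hA]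
      exact hM s (abs_le.2 hs))
    (Set.mem_Icc.2 ⟨by linarith [abs_nonneg t], by linarith [abs_nonneg t]⟩ :
      (0 : ℝ) ∈ Set.Icc (-T) T) (abs_le.1 ht)
  simp only [neg_zero, expGroup_zero, one_mul, mul_one, sub_zero, Real.norm_eq_abs] at key
  calc _ = ‖(expGroup A (-t) * B * expGroup A t) h‖ := by
        simp only [mul_apply_eq_comp, norm_expGroup_apply hA]
    _ ≤ _ := by
        have := norm_sub_norm_le ((expGroup A (-t) * B * expGroup A t) h) (B h)
        linarith

end UnitaryGroup

/-! ### Orthogonal block decompositions. -/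

/-- A decomposition of a Hilbert space into a family of mutually orthogonal subspaces, given by
the orthogonal projections. -/
structure IsBlockDecomposition {H ι : Type*} [NormedAddCommGroup H] [InnerProductSpace ℂ H]
    (P : ι → H →L[ℂ] H) : Prop where
  proj_self : ∀ i x, P i (P i x) = P i x
  proj_ne : ∀ i j, i ≠ j → ∀ x, P i (P j x) = 0
  inner_proj : ∀ i x y, inner ℂ (P i x) y = inner ℂ x (P i y)
  hasSum : ∀ x, HasSum (fun i => P i x) x

namespace IsBlockDecomposition

variable {H ι : Type*} [NormedAddCommGroup H] [InnerProductSpace ℂ H] {P : ι → H →L[ℂ] H}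

theorem hasSum_norm_sq (hP : IsBlockDecomposition P) (x : H) :
    HasSum (fun i => ‖P i x‖ ^ 2) (‖x‖ ^ 2) := by
  have h := (hP.hasSum x).mapL (innerSL ℂ x)
  have h2 := h.mapL Complex.reCLM
  simp only [innerSL_apply_apply, Complex.reCLM_apply] at h2
  convert h2 using 1
  · ext i
    rw [← hP.proj_self, ← hP.inner_proj, hP.proj_self]
    exact (inner_self_eq_norm_sq (𝕜 := ℂ) _).symm
  · exact (inner_self_eq_norm_sq (𝕜 := ℂ) _).symm

theorem tsum_enorm_sq (hP : IsBlockDecomposition P) (x : H) :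
    ∑' i, ‖P i x‖ₑ ^ (2 : ℝ) = ‖x‖ₑ ^ (2 : ℝ) := by
  have e : ∀ y : H, ‖y‖ₑ ^ (2 : ℝ) = ENNReal.ofReal (‖y‖ ^ 2) := fun y => by
    rw [ENNReal.rpow_ofNat, ENNReal.ofReal_pow (norm_nonneg _), ofReal_norm]
  simp_rw [e]
  rw [← (hP.hasSum_norm_sq x).tsum_eq,
    ENNReal.ofReal_tsum_of_nonneg (fun _ => by positivity) (hP.hasSum_norm_sq x).summable]

theorem enorm_le_of_schur (hP : IsBlockDecomposition P) (k : ι → ι → ℝ≥0∞)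
    (K : ℝ≥0∞) (hrow : ∀ i, ∑' j, k i j ≤ K) (hcol : ∀ j, ∑' i, k i j ≤ K) (x y : H)
    (h : ∀ i, ‖P i x‖ₑ ≤ ∑' j, k i j * ‖P j y‖ₑ) : ‖x‖ₑ ≤ K * ‖y‖ₑ := by
  have := ENNReal.tsum_rpow_le_of_schur 2 one_le_two k K hrow hcol _ _ h
  rw [hP.tsum_enorm_sq, hP.tsum_enorm_sq, ← ENNReal.mul_rpow_of_nonneg _ _ zero_le_two] at this
  exact (ENNReal.rpow_le_rpow_iff two_pos).1 this

theorem ext (hP : IsBlockDecomposition P) {x y : H} (h : ∀ i, P i x = P i y) : x = y :=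
  (hP.hasSum x).unique (by simpa only [h] using hP.hasSum y)

theorem enorm_le_tsum_of_hasSum {E : Type*} [NormedAddCommGroup E] {f : ι → E} {x : E}
    (h : HasSum f x) : ‖x‖ₑ ≤ ∑' i, ‖f i‖ₑ := by
  have h1 : Filter.Tendsto (fun s : Finset ι => ‖∑ i ∈ s, f i‖ₑ) Filter.atTop (nhds ‖x‖ₑ) :=
    Filter.Tendsto.enorm h
  exact le_of_tendsto h1 (Filter.Eventually.of_forall fun s =>
    (enorm_sum_le _ _).trans (ENNReal.sum_le_tsum s))

/-- Existence of the multiplication operators by a family of numbers that is constant outside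
a finite set. -/
theorem exists_diagonal (hP : IsBlockDecomposition P) (w : ι → ℝ) (c : ℝ)
    (hw : {i | w i ≠ c}.Finite) : ∃ W : H →L[ℂ] H, ∀ i x, P i (W x) = (w i : ℂ) • P i x := by
  classical
  refine ⟨(c : ℂ) • ContinuousLinearMap.id ℂ H + ∑ i ∈ hw.toFinset, ((w i - c : ℝ) : ℂ) • P i, ?_⟩
  intro i x
  have : ∀ j ∈ hw.toFinset, P i (((w j - c : ℝ) : ℂ) • P j x) =
      if j = i then ((w i - c : ℝ) : ℂ) • P i x else 0 := by
    intro j _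
    split_ifs with h
    · subst h; rw [map_smul, hP.proj_self]
    · rw [map_smul, hP.proj_ne i j (Ne.symm h), smul_zero]
  simp only [_root_.add_apply, _root_.smul_apply,
    ContinuousLinearMap.id_apply, _root_.sum_apply, map_add, map_sum, map_smul]
  simp only [map_smul] at this
  rw [Finset.sum_congr rfl this, Finset.sum_ite_eq']
  by_cases h : w i = c
  · simp [h]
  · rw [if_pos (by simpa using h), ← add_smul]; simp

end IsBlockDecomposition

/-! ### Nets of polynomial growth. -/

/-- A discrete set with pseudo-distance `ρ` and point masses `V` of polynomial growth of
order `n`. -/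
structure IsDoublingNet {ι : Type*} (ρ : ι → ι → ℝ) (V : ι → ℝ) (n C : ℝ) : Prop where
  nonneg : ∀ i j, 0 ≤ ρ i j
  self : ∀ i, ρ i i = 0
  symm : ∀ i j, ρ i j = ρ j i
  triangle : ∀ i j k, ρ i k ≤ ρ i j + ρ j k
  pos : ∀ i, 0 < V i
  tsum_one_le : ∀ (j : ι) (R : ℝ), 1 ≤ R →
    ∑' i, {i | ρ i j < R}.indicator (fun _ => (1 : ℝ≥0∞)) i ≤ ENNReal.ofReal (C * R ^ n)
  tsum_mass_le : ∀ (j : ι) (R : ℝ), 1 ≤ R →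
    ∑' i, {i | ρ i j < R}.indicator (fun i => ENNReal.ofReal (V i)) i
      ≤ ENNReal.ofReal (C * R ^ n * V j)

namespace IsDoublingNet

variable {ι : Type*} {ρ : ι → ι → ℝ} {V : ι → ℝ} {n C : ℝ}

theorem finite_lt (h : IsDoublingNet ρ V n C) (j : ι) (R : ℝ) : {i | ρ i j < R}.Finite := by
  have h1 := h.tsum_one_le j (max R 1) (le_max_right _ _)
  rw [← tsum_subtype, ENNReal.tsum_set_one] at h1
  have h2 : {i | ρ i j < max R 1}.encard ≠ ⊤ := by
    intro h3
    rw [h3] at h1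
    simp at h1
  exact (Set.encard_ne_top_iff.1 h2).subset fun i hi => by
    simp only [Set.mem_ofPred_eq] at hi ⊢
    exact lt_max_of_lt_left hi

theorem exists_tsum_rpow_neg_le (h : IsDoublingNet ρ V n C) (hC : 0 < C) (hn : 0 < n) (s : ℝ)
    (hs : n < s) : ∃ K : ℝ, 0 < K ∧
      ∀ j, ∑' i, ENNReal.ofReal ((1 + ρ i j) ^ (-s)) ≤ ENNReal.ofReal K := by
  obtain ⟨D, hD, hsum⟩ := exists_tsum_mul_one_add_rpow_neg_le n s hn hs
  refine ⟨D * C, by positivity, fun j => ?_⟩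
  have := hsum (fun i => ρ i j) (fun _ => 1) (ENNReal.ofReal C) (fun i => h.nonneg i j)
    (fun R hR => by rw [← ENNReal.ofReal_mul hC.le]; exact h.tsum_one_le j R hR)
  simpa [ENNReal.ofReal_mul hD.le] using this

/-- Dividing distances by T turns a ball of radius R into one of radius RT, whence the factor T^n.
-/
theorem exists_tsum_mass_rpow_neg_le (h : IsDoublingNet ρ V n C) (hC : 0 < C) (hn : 0 < n) (s : ℝ)
    (hs : n < s) : ∃ K : ℝ, 0 < K ∧ ∀ (T : ℝ) (j : ι), 1 ≤ T →
      ∑' i, ENNReal.ofReal (V i) * ENNReal.ofReal ((1 + ρ i j / T) ^ (-s))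
        ≤ ENNReal.ofReal (K * T ^ n * V j) := by
  obtain ⟨D, hD, hsum⟩ := exists_tsum_mul_one_add_rpow_neg_le n s hn hs
  refine ⟨D * C, by positivity, fun T j hT => ?_⟩
  have hT0 : 0 < T := by linarith
  have := hsum (fun i => ρ i j / T) (fun i => ENNReal.ofReal (V i))
    (ENNReal.ofReal (C * T ^ n * V j)) (fun i => div_nonneg (h.nonneg i j) hT0.le)
    (fun R hR => by
      have := h.pos j
      rw [← ENNReal.ofReal_mul (by positivity)]
      simp only [div_lt_iff₀ hT0]
      refine (h.tsum_mass_le j (R * T) (one_le_mul_of_one_le_of_one_le hR hT)).trans_eq ?_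
      rw [Real.mul_rpow (by linarith) hT0.le]
      congr 1; ring)
  refine this.trans_eq ?_
  rw [← ENNReal.ofReal_mul hD.le]
  congr 1; ring

end IsDoublingNet

/-! ### Commutators with weights and finite speed of propagation. -/

/-- For a weight with Lipschitz constant 1/T, the difference of powers gains 1/T and loses one power
of the weight; exchanging x for y costs only powers of 1 + r, which off-diagonal decay absorbs. -/
theorem abs_pow_succ_sub_pow_succ_le {x y r T : ℝ} (hx : 1 ≤ x) (hy : 1 ≤ y) (hT : 1 ≤ T)
    (hr : 0 ≤ r) (h : |x - y| ≤ r / T) (m : ℕ) :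
    |x ^ (m + 1) - y ^ (m + 1)| ≤ (m + 1) / T * (1 + r) ^ (m + 1) * y ^ m := by
  have hrT : r / T ≤ r := div_le_self hr hT
  have h1 : max |x| |y| ≤ (1 + r) * y := by
    rw [abs_of_nonneg (by linarith), abs_of_nonneg (by linarith)]
    refine max_le ?_ ?_ <;> nlinarith [(abs_le.1 h).2]
  calc _ ≤ |x - y| * (m + 1 : ℕ) * max |x| |y| ^ m := abs_pow_sub_pow_le ..
    _ ≤ (1 + r) / T * (m + 1 : ℕ) * ((1 + r) * y) ^ m := by
      gcongr
      exact h.trans (by gcongr; linarith)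
    _ = _ := by push_cast; rw [mul_pow]; ring

namespace IsBlockDecomposition

variable {H ι : Type*} [NormedAddCommGroup H] [InnerProductSpace ℂ H] {P : ι → H →L[ℂ] H}
  {ρ : ι → ι → ℝ}

/-- Commutators with powers of a Lipschitz weight lower the power by one. -/
theorem norm_commutator_le (hP : IsBlockDecomposition P) (hρ : ∀ i j, 0 ≤ ρ i j)
    (hρs : ∀ i j, ρ i j = ρ j i) (A : H →L[ℂ] H) (b c K : ℝ) (hc : 0 ≤ c) (hK0 : 0 ≤ K)
    (hA : ∀ i j y, ‖P i (A (P j y))‖ ≤ c * (1 + ρ i j) ^ (-b) * ‖P j y‖) (k : ℕ)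
    (hK : ∀ j, ∑' i, ENNReal.ofReal ((1 + ρ i j) ^ (-(b - k))) ≤ ENNReal.ofReal K)
    (T : ℝ) (hT : 1 ≤ T) (w : ι → ℝ) (hw : ∀ i, 1 ≤ w i) (hwL : ∀ i j, |w i - w j| ≤ ρ i j / T)
    (m : ℕ) (hm : m + 1 ≤ k) (W W' : H →L[ℂ] H)
    (hW : ∀ i x, P i (W x) = ((w i ^ (m + 1) : ℝ) : ℂ) • P i x)
    (hW' : ∀ i x, P i (W' x) = ((w i ^ m : ℝ) : ℂ) • P i x) (y : H) :
    ‖(W * A - A * W) y‖ ≤ (m + 1) / T * c * K * ‖W' y‖ := by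
  have hT0 : 0 < T := by linarith
  set q : ℝ := (m + 1) / T * c
  have hq : 0 ≤ q := by positivity
  have main : ‖(W * A - A * W) y‖ₑ ≤ ENNReal.ofReal (q * K) * ‖W' y‖ₑ := by
    have hrow : ∀ j, ∑' i, ENNReal.ofReal (q * (1 + ρ i j) ^ (-(b - k)))
        ≤ ENNReal.ofReal (q * K) := fun j => by
      simp_rw [ENNReal.ofReal_mul hq]
      rw [ENNReal.tsum_mul_left]
      gcongr
      exact hK j
    refine hP.enorm_le_of_schur (fun i j => ENNReal.ofReal (q * (1 + ρ i j) ^ (-(b - k)))) _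
      (fun i => by simpa only [hρs i] using hrow i) hrow _ _ fun i => ?_
    have s1 : HasSum (fun j => P i (A (P j y))) (P i (A y)) :=
      ((hP.hasSum y).mapL A).mapL (P i)
    have s2 : HasSum (fun j => P i (A (P j (W y)))) (P i (A (W y))) :=
      ((hP.hasSum (W y)).mapL A).mapL (P i)
    have s3 := (s1.const_smul ((w i ^ (m + 1) : ℝ) : ℂ)).sub s2
    have e : P i ((W * A - A * W) y) = ((w i ^ (m + 1) : ℝ) : ℂ) • P i (A y) - P i (A (W y)) := by
      rw [← hW]; simp
    rw [e]
    refine (enorm_le_tsum_of_hasSum s3).trans (ENNReal.tsum_le_tsum fun j => ?_)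
    rw [hW, map_smul, map_smul, ← sub_smul, hW', ← ofReal_norm, ← ofReal_norm,
      ← ENNReal.ofReal_mul (by have := hρ i j; positivity)]
    refine ENNReal.ofReal_le_ofReal ?_
    have h1 : 1 ≤ 1 + ρ i j := by linarith [hρ i j]
    have hw0 : 0 ≤ w j := by linarith [hw j]
    rw [norm_smul, norm_smul, ← Complex.ofReal_sub, Complex.norm_real, Complex.norm_real,
      Real.norm_eq_abs, Real.norm_of_nonneg (by positivity)]
    calc _ ≤ ((m + 1) / T * (1 + ρ i j) ^ (m + 1) * w j ^ m) *
          (c * (1 + ρ i j) ^ (-b) * ‖P j y‖) := by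
          gcongr
          · exact abs_pow_succ_sub_pow_succ_le (hw i) (hw j) hT (hρ i j) (hwL i j) m
          · exact hA i j y
      -- Raising m + 1 to k gives one kernel, of decay b - k, for all steps of the induction.
      _ ≤ ((m + 1) / T * (1 + ρ i j) ^ k * w j ^ m) *
          (c * (1 + ρ i j) ^ (-b) * ‖P j y‖) := by
          gcongr
      _ = _ := by
          rw [neg_sub, Real.rpow_sub (by linarith), Real.rpow_neg (by linarith),
            Real.rpow_natCast]
          simp only [q]; ring
  rw [← ofReal_norm, ← ofReal_norm, ← ENNReal.ofReal_mul (by positivity)] at main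
  exact (ENNReal.ofReal_le_ofReal_iff (by positivity)).1 main

/-- Propagation at finite speed in the `L²` sense: on the time scale `T`, the group `e^{itA}`
transports mass over distances of order `T`. -/
theorem exists_norm_weight_expGroup_le [CompleteSpace H] (hP : IsBlockDecomposition P) {V : ι → ℝ}
    {n C : ℝ} (hC : 0 < C) (hn : 0 < n) (hρ : IsDoublingNet ρ V n C) (A : H →L[ℂ] H)
    (hA : IsSelfAdjoint A) (b c : ℝ) (hc : 0 ≤ c)
    (hAP : ∀ i j y, ‖P i (A (P j y))‖ ≤ c * (1 + ρ i j) ^ (-b) * ‖P j y‖) (k : ℕ)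
    (hk : n < b - k) :
    ∃ D : ℝ, 0 < D ∧ ∀ (t T : ℝ) (j : ι) (h : H), 1 ≤ T → |t| ≤ T →
      ∑' i, (ENNReal.ofReal ((1 + ρ i j / T) ^ k) * ‖P i (expGroup A t (P j h))‖ₑ) ^ (2 : ℝ) ≤
        (ENNReal.ofReal D * ‖P j h‖ₑ) ^ (2 : ℝ) := by
  obtain ⟨K, hK0, hK⟩ := hρ.exists_tsum_rpow_neg_le hC hn (b - k) hk
  -- Induction on the power of the weight: the commutator with w^(m+1) is controlled by w^m,
  -- uniformly over all admissible weights.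
  have claim : ∀ m : ℕ, m ≤ k → ∃ D : ℝ, 0 < D ∧ ∀ (t T : ℝ) (j : ι) (h : H) (w : ι → ℝ)
      (W : ℕ → H →L[ℂ] H), 1 ≤ T → |t| ≤ T → (∀ i, 1 ≤ w i) → w j = 1 →
      (∀ i i', |w i - w i'| ≤ ρ i i' / T) →
      (∀ l i x, P i (W l x) = ((w i ^ l : ℝ) : ℂ) • P i x) →
      ‖W m (expGroup A t (P j h))‖ ≤ D * ‖P j h‖ := by
    intro m
    induction m with
    | zero =>
      refine fun _ => ⟨1, one_pos, fun t T j h w W _ _ _ _ _ hW => ?_⟩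
      have : W 0 (expGroup A t (P j h)) = expGroup A t (P j h) := hP.ext fun i => by
        rw [hW]; simp
      rw [this, norm_expGroup_apply hA, one_mul]
    | succ m ih =>
      intro hm
      obtain ⟨D, hD, ihD⟩ := ih (by omega)
      refine ⟨1 + (m + 1) * c * K * D, by positivity, fun t T j h w W hT ht hw hwj hwL hW => ?_⟩
      have hT0 : 0 < T := by linarith
      have h1 : W (m + 1) (P j h) = P j h := hP.ext fun i => by
        rw [hW]
        by_cases hij : i = j
        · subst hij; simp [hwj]
        · simp [hP.proj_ne i j hij]
      have h2 := norm_apply_expGroup_le hA (W (m + 1)) (P j h) T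
        ((m + 1) / T * c * K * (D * ‖P j h‖)) (fun s hs =>
          (hP.norm_commutator_le hρ.nonneg hρ.symm A b c K hc hK0.le hAP k hK T hT w hw hwL m hm
            (W (m + 1)) (W m) (hW _) (hW _) _).trans (by
              gcongr
              exact ihD s T j h w W hT hs hw hwj hwL hW)) t ht
      rw [h1] at h2
      refine h2.trans ?_
      -- The 1/T gained in the commutator cancels the length T of the time interval.
      calc _ ≤ ‖P j h‖ + (m + 1) / T * c * K * (D * ‖P j h‖) * T := by gcongr
        _ = _ := by field_simp
  obtain ⟨D, hD, hclaim⟩ := claim k le_rfl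
  refine ⟨D, hD, fun t T j h hT ht => ?_⟩
  have hT0 : 0 < T := by linarith
  rw [ENNReal.tsum_eq_iSup_sum]
  refine iSup_le fun s => ?_
  obtain ⟨N, hN0, hN⟩ : ∃ N : ℝ, 0 ≤ N ∧ ∀ i ∈ s, ρ i j ≤ N :=
    ⟨∑ i ∈ s, ρ i j, Finset.sum_nonneg fun i _ => hρ.nonneg i j, fun i hi =>
      Finset.single_le_sum (f := fun i => ρ i j) (fun i _ => hρ.nonneg i j) hi⟩
  -- The distance is truncated at N so that powers of w are bounded operators: w is constant off a
  -- finite set. The Lipschitz constant remains 1/T and D does not depend on N; N is chosen so that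
  -- the truncation is invisible on s.
  set w : ι → ℝ := fun i => 1 + min (ρ i j) N / T
  have hw : ∀ i, 1 ≤ w i := fun i => by
    have : 0 ≤ min (ρ i j) N / T := div_nonneg (le_min (hρ.nonneg i j) hN0) hT0.le
    simp only [w]; linarith
  have hwL : ∀ i i', |w i - w i'| ≤ ρ i i' / T := fun i i' => by
    simp only [w]
    rw [add_sub_add_left_eq_sub, ← sub_div, abs_div, abs_of_pos hT0]
    gcongr
    refine (abs_min_sub_min_le_max _ _ _ _).trans ?_
    rw [sub_self, abs_zero, max_eq_left (abs_nonneg _), abs_le]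
    constructor
    · linarith [hρ.triangle i' i j, hρ.symm i i']
    · linarith [hρ.triangle i i' j]
  have hex : ∀ l : ℕ, ∃ W : H →L[ℂ] H, ∀ i x, P i (W x) = ((w i ^ l : ℝ) : ℂ) • P i x := fun l =>
    hP.exists_diagonal (fun i => w i ^ l) ((1 + N / T) ^ l) <|
      (hρ.finite_lt j N).subset fun i hi => by
        simp only [Set.mem_ofPred_eq] at hi ⊢
        by_contra hlt
        exact hi (by simp only [w, min_eq_right (not_lt.1 hlt)])
  choose W hW using hex
  have h1 := hclaim t T j h w W hT ht hw (by simp [w, hρ.self, hN0]) hwL hW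
  have h2 : ‖W k (expGroup A t (P j h))‖ₑ ≤ ENNReal.ofReal D * ‖P j h‖ₑ := by
    rw [← ofReal_norm, ← ofReal_norm, ← ENNReal.ofReal_mul hD.le]
    exact ENNReal.ofReal_le_ofReal h1
  calc _ ≤ ∑ i ∈ s, ‖P i (W k (expGroup A t (P j h)))‖ₑ ^ (2 : ℝ) := by
        refine Finset.sum_le_sum fun i hi => ?_
        rw [hW, enorm_smul]
        refine ENNReal.rpow_le_rpow (mul_le_mul_left (le_of_eq ?_) _) zero_le_two
        rw [← ofReal_norm, Complex.norm_real,
          Real.norm_of_nonneg (pow_nonneg (by linarith [hw i]) _)]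
        simp only [w, min_eq_left (hN i hi)]
    _ ≤ ∑' i, ‖P i (W k (expGroup A t (P j h)))‖ₑ ^ (2 : ℝ) := ENNReal.sum_le_tsum s
    _ = ‖W k (expGroup A t (P j h))‖ₑ ^ (2 : ℝ) := hP.tsum_enorm_sq _
    _ ≤ _ := ENNReal.rpow_le_rpow h2 zero_le_two

end IsBlockDecomposition

/-! ### The group on volume-weighted ℓ^p sums of blocks. -/

namespace IsBlockDecomposition

variable {H ι : Type*} [NormedAddCommGroup H] [InnerProductSpace ℂ H] {P : ι → H →L[ℂ] H}
  {ρ : ι → ι → ℝ}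

/-- Cauchy–Schwarz against (1 + ρ/T)^(-k): since 2k > n, the sum of V_i (1 + ρ/T)^(-2k) is O(T^n
V_j), and its square root gives the factor T^(n/2) √V_j. -/
theorem exists_tsum_sqrt_mul_expGroup_le [CompleteSpace H] (hP : IsBlockDecomposition P)
    {V : ι → ℝ} {n C : ℝ} (hC : 0 < C) (hn : 0 < n) (hρ : IsDoublingNet ρ V n C)
    (A : H →L[ℂ] H) (hA : IsSelfAdjoint A) (b c : ℝ) (hc : 0 ≤ c)
    (hAP : ∀ i j y, ‖P i (A (P j y))‖ ≤ c * (1 + ρ i j) ^ (-b) * ‖P j y‖) (k : ℕ)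
    (hk : n < b - k) (hkn : n < 2 * k) :
    ∃ D : ℝ, 0 < D ∧ ∀ (t T : ℝ) (j : ι) (h : H), 1 ≤ T → |t| ≤ T → ∀ s : Finset ι,
      ∑ i ∈ s, √(V i) * ‖P i (expGroup A t (P j h))‖ ≤
        D * T ^ (n / 2) * (√(V j) * ‖P j h‖) := by
  obtain ⟨D, hD, hDb⟩ := hP.exists_norm_weight_expGroup_le hC hn hρ A hA b c hc hAP k hk
  obtain ⟨K, hK, hKb⟩ := hρ.exists_tsum_mass_rpow_neg_le hC hn (2 * k) hkn
  refine ⟨√K * D, by positivity, fun t T j h hT ht s => ?_⟩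
  have hT0 : 0 < T := by linarith
  have hVj := hρ.pos j
  have hpos : ∀ i, 0 < 1 + ρ i j / T := fun i => by
    have := div_nonneg (hρ.nonneg i j) hT0.le
    linarith
  have main : ∑' i, ENNReal.ofReal √(V i) * ‖P i (expGroup A t (P j h))‖ₑ ≤
      ENNReal.ofReal (√K * D * T ^ (n / 2) * (√(V j) * ‖P j h‖)) := by
    have hold := ENNReal.tsum_mul_le_Lp_mul_Lq Real.HolderConjugate.two_two
      (fun i => ENNReal.ofReal (√(V i) * ((1 + ρ i j / T) ^ k)⁻¹))
      (fun i => ENNReal.ofReal ((1 + ρ i j / T) ^ k) * ‖P i (expGroup A t (P j h))‖ₑ)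
    have e1 : ∀ i, ENNReal.ofReal (√(V i) * ((1 + ρ i j / T) ^ k)⁻¹) *
        (ENNReal.ofReal ((1 + ρ i j / T) ^ k) * ‖P i (expGroup A t (P j h))‖ₑ) =
        ENNReal.ofReal √(V i) * ‖P i (expGroup A t (P j h))‖ₑ := fun i => by
      have := hpos i
      rw [← mul_assoc, ← ENNReal.ofReal_mul (by positivity), inv_mul_cancel_right₀ (by positivity)]
    have e2 : ∀ i, ENNReal.ofReal (√(V i) * ((1 + ρ i j / T) ^ k)⁻¹) ^ (2 : ℝ) =
        ENNReal.ofReal (V i) * ENNReal.ofReal ((1 + ρ i j / T) ^ (-(2 * k) : ℝ)) := fun i => by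
      have := hpos i
      have hV := hρ.pos i
      rw [ENNReal.rpow_ofNat, ← ENNReal.ofReal_pow (by positivity),
        ← ENNReal.ofReal_mul hV.le, mul_pow, Real.sq_sqrt hV.le, Real.rpow_neg this.le,
        mul_comm (2 : ℝ), Real.rpow_mul this.le, Real.rpow_natCast, inv_pow, Real.rpow_ofNat]
    simp only [e1, e2] at hold
    refine hold.trans ?_
    calc _ ≤ (ENNReal.ofReal (K * T ^ n * V j)) ^ (1 / 2 : ℝ) *
          ((ENNReal.ofReal D * ‖P j h‖ₑ) ^ (2 : ℝ)) ^ (1 / 2 : ℝ) := by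
          gcongr
          · exact hKb T j hT
          · exact hDb t T j h hT ht
      _ = _ := by
          rw [← ENNReal.rpow_mul, ← ofReal_norm, ← ENNReal.ofReal_mul hD.le,
            ENNReal.ofReal_rpow_of_nonneg (by positivity) (by norm_num)]
          norm_num only [ENNReal.rpow_one]
          rw [← ENNReal.ofReal_mul (by positivity), Real.mul_rpow (by positivity) hVj.le,
            Real.mul_rpow hK.le (by positivity), ← Real.rpow_mul hT0.le, Real.sqrt_eq_rpow,
            Real.sqrt_eq_rpow]
          congr 1; ring_nf
  have h1 := (ENNReal.sum_le_tsum s).trans main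
  have e : ∀ i, ENNReal.ofReal √(V i) * ‖P i (expGroup A t (P j h))‖ₑ =
      ENNReal.ofReal (√(V i) * ‖P i (expGroup A t (P j h))‖) := fun i => by
    rw [ENNReal.ofReal_mul (by positivity), ofReal_norm]
  simp only [e] at h1
  rw [← ENNReal.ofReal_sum_of_nonneg (fun i _ => by positivity)] at h1
  exact (ENNReal.ofReal_le_ofReal_iff (by positivity)).1 h1

theorem norm_sum_proj_sq (hP : IsBlockDecomposition P) (F : Finset ι) (y : H) :
    ‖∑ j ∈ F, P j y‖ ^ 2 = ∑ j ∈ F, ‖P j y‖ ^ 2 := by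
  classical
  have h0 : ∀ i, P i (∑ j ∈ F, P j y) = if i ∈ F then P i y else 0 := fun i => by
    rw [map_sum, ← Finset.sum_ite_eq F i fun j => P j y]
    refine Finset.sum_congr rfl fun j _ => ?_
    split_ifs with h
    · rw [h, hP.proj_self]
    · exact hP.proj_ne i j h y
  have h1 := hP.hasSum_norm_sq (∑ j ∈ F, P j y)
  have h2 := hasSum_sum_of_ne_finset_zero (L := SummationFilter.unconditional ι)
    (f := fun i => ‖P i (∑ j ∈ F, P j y)‖ ^ 2) (s := F)
    (fun i hi => by simp [h0, hi])
  rw [h1.unique h2]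
  exact Finset.sum_congr rfl fun i hi => by rw [h0, if_pos hi]

/-- Normalisation for interpolation: with g_i = ‖P_i y‖/√V_i and masses V_i, the ℓ² norm is the
Hilbert norm, the ℓ¹ norm carries weights √V_i, and the ℓ^p norm carries V_i^(1/p - 1/2). -/
theorem mul_div_sqrt_rpow {v x p : ℝ} (hv : 0 < v) (hx : 0 ≤ x) (hp : p ≠ 0) :
    v * (x / √v) ^ p = (v ^ (1 / p - 1 / 2) * x) ^ p := by
  rw [Real.div_rpow hx (Real.sqrt_nonneg _), Real.mul_rpow (by positivity) hx, Real.sqrt_eq_rpow,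
    ← Real.rpow_mul hv.le, ← Real.rpow_mul hv.le, mul_div_left_comm, mul_comm]
  congr 1
  nth_rewrite 1 [← Real.rpow_one v]
  rw [← Real.rpow_sub hv]
  congr 1
  field_simp

/-- The group `e^{itA}` on `ℓ^p` sums of blocks weighted by volumes. -/
theorem exists_tsum_expGroup_rpow_le [CompleteSpace H] (hP : IsBlockDecomposition P)
    {V : ι → ℝ} {n C : ℝ} (hC : 0 < C) (hn : 0 < n) (hρ : IsDoublingNet ρ V n C)
    (A : H →L[ℂ] H) (hA : IsSelfAdjoint A) (b c : ℝ) (hc : 0 ≤ c)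
    (hAP : ∀ i j y, ‖P i (A (P j y))‖ ≤ c * (1 + ρ i j) ^ (-b) * ‖P j y‖) (k : ℕ)
    (hk : n < b - k) (hkn : n < 2 * k) (p : ℝ) (hp1 : 1 ≤ p) (hp2 : p < 2) :
    ∃ D : ℝ, 0 < D ∧ ∀ (t : ℝ) (y : H),
      ∑' i, (ENNReal.ofReal (V i ^ (1 / p - 1 / 2)) * ‖P i (expGroup A t y)‖ₑ) ^ p ≤
        ENNReal.ofReal (D * ((1 + |t|) ^ (n * (1 / p - 1 / 2))) ^ p) *
          ∑' j, (ENNReal.ofReal (V j ^ (1 / p - 1 / 2)) * ‖P j y‖ₑ) ^ p := by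
  classical
  obtain ⟨D, hD, hDb⟩ :=
    hP.exists_tsum_sqrt_mul_expGroup_le hC hn hρ A hA b c hc hAP k hk hkn
  obtain ⟨Q, hQ, hQb⟩ := exists_sum_rpow_le_of_splitting p hp1 hp2
  refine ⟨Q * D ^ (2 - p), by positivity, fun t y => ?_⟩
  have hp0 : 0 < p := by linarith
  set T := 1 + |t| with hTdef
  have hT : 1 ≤ T := by linarith [abs_nonneg t]
  have hT0 : 0 < T := by linarith
  have htT : |t| ≤ T := by linarith
  set M := D * T ^ (n / 2)
  have hM : M ^ (2 - p) = D ^ (2 - p) * (T ^ (n * (1 / p - 1 / 2))) ^ p := by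
    rw [Real.mul_rpow hD.le (by positivity), ← Real.rpow_mul hT0.le, ← Real.rpow_mul hT0.le]
    congr 2
    field_simp
  have conv : ∀ (i : ι) (x : H), (ENNReal.ofReal (V i ^ (1 / p - 1 / 2)) * ‖P i x‖ₑ) ^ p =
      ENNReal.ofReal (V i * (‖P i x‖ / √(V i)) ^ p) := fun i x => by
    have := hρ.pos i
    rw [mul_div_sqrt_rpow this (norm_nonneg _) hp0.ne', ← ofReal_norm,
      ← ENNReal.ofReal_mul (by positivity), ENNReal.ofReal_rpow_of_nonneg (by positivity) hp0.le]
  have fin : ∀ E F : Finset ι,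
      ∑ i ∈ E, V i * (‖P i (expGroup A t (∑ j ∈ F, P j y))‖ / √(V i)) ^ p ≤
        Q * M ^ (2 - p) * ∑ j ∈ F, V j * (‖P j y‖ / √(V j)) ^ p := by
    intro E F
    refine hQb E F V _ _ M (by positivity) hρ.pos (fun i => by positivity)
      (fun i => by positivity) fun s => ?_
    -- The splitting is linear: the blocks indexed by s are measured in ℓ¹ through Cauchy–Schwarz,
    -- the others in ℓ² through unitarity.
    refine ⟨fun i => ‖P i (expGroup A t (∑ j ∈ F with j ∈ s, P j y))‖ / √(V i),
      fun i => ‖P i (expGroup A t (∑ j ∈ F with j ∉ s, P j y))‖ / √(V i),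
      fun i => by positivity, fun i => by positivity, fun i => ?_, ?_, ?_⟩
    · rw [← Finset.sum_filter_add_sum_filter_not F (· ∈ s), map_add, map_add, ← add_div]
      gcongr
      exact norm_add_le _ _
    · have e : ∀ (i : ι) (x : ℝ), V i * (x / √(V i)) = √(V i) * x := fun i x => by
        have := hρ.pos i
        nth_rewrite 1 [← Real.mul_self_sqrt this.le]
        field_simp
      simp only [e]
      calc _ ≤ ∑ i ∈ E, ∑ j ∈ F with j ∈ s, √(V i) * ‖P i (expGroup A t (P j y))‖ := by
            refine Finset.sum_le_sum fun i _ => ?_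
            rw [map_sum, map_sum, ← Finset.mul_sum]
            gcongr
            exact norm_sum_le _ _
        _ = ∑ j ∈ F with j ∈ s, ∑ i ∈ E, √(V i) * ‖P i (expGroup A t (P j y))‖ :=
            Finset.sum_comm
        _ ≤ ∑ j ∈ F with j ∈ s, M * (√(V j) * ‖P j y‖) :=
            Finset.sum_le_sum fun j _ => hDb t T j y hT htT E
        _ = _ := by
            rw [← Finset.mul_sum, Finset.sum_filter]
            simp only [Set.indicator_apply]
    · have e : ∀ (i : ι) (x : ℝ), V i * (x / √(V i)) ^ 2 = x ^ 2 := fun i x => by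
        have := hρ.pos i
        rw [div_pow, Real.sq_sqrt this.le]
        field_simp
      simp only [e]
      have hs := hP.hasSum_norm_sq (expGroup A t (∑ j ∈ F with j ∉ s, P j y))
      calc _ ≤ ‖expGroup A t (∑ j ∈ F with j ∉ s, P j y)‖ ^ 2 :=
            sum_le_hasSum E (fun i _ => by positivity) hs
        _ = ∑ j ∈ F with j ∉ s, ‖P j y‖ ^ 2 := by
            rw [norm_expGroup_apply hA, hP.norm_sum_proj_sq]
        _ ≤ _ := by
            rw [Finset.sum_filter]
            simp only [Set.indicator_apply, Set.mem_compl_iff, le_refl]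
  rw [ENNReal.tsum_eq_iSup_sum]
  refine iSup_le fun E => ?_
  -- Interpolation handles finitely many input blocks; with E fixed, continuity allows the passage
  -- to all of y.
  have lim : Filter.Tendsto (fun F : Finset ι =>
      ∑ i ∈ E, (ENNReal.ofReal (V i ^ (1 / p - 1 / 2)) *
        ‖P i (expGroup A t (∑ j ∈ F, P j y))‖ₑ) ^ p) Filter.atTop
      (nhds (∑ i ∈ E, (ENNReal.ofReal (V i ^ (1 / p - 1 / 2)) *
        ‖P i (expGroup A t y)‖ₑ) ^ p)) := by
    have hy : Filter.Tendsto (fun F : Finset ι => ∑ j ∈ F, P j y) Filter.atTop (nhds y) :=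
      hP.hasSum y
    refine tendsto_finsetSum _ fun i _ => ?_
    refine (ENNReal.continuous_rpow_const.tendsto _).comp
      (ENNReal.Tendsto.const_mul ?_ (Or.inr ENNReal.ofReal_ne_top))
    exact (((P i).continuous.comp (expGroup A t).continuous).enorm.tendsto y).comp hy
  refine le_of_tendsto lim (Filter.Eventually.of_forall fun F => ?_)
  simp only [conv]
  rw [← ENNReal.ofReal_sum_of_nonneg fun i _ => by have := hρ.pos i; positivity]
  refine (ENNReal.ofReal_le_ofReal (fin E F)).trans ?_
  rw [ENNReal.ofReal_mul (by positivity), hM, ← mul_assoc,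
    ENNReal.ofReal_sum_of_nonneg fun i _ => by have := hρ.pos i; positivity]
  gcongr
  exact ENNReal.sum_le_tsum F

end IsBlockDecomposition

/-! ### Separated nets, partitions and doubling measures. -/

section Net

variable {X : Type*} [MetricSpace X]

theorem exists_separated_net (τ : ℝ) (hτ : 0 < τ) :
    ∃ S : Set X, S.Pairwise (fun x y => τ ≤ dist x y) ∧ ∀ x, ∃ y ∈ S, dist x y < τ := by
  obtain ⟨S, hS⟩ := zorn_subset {S : Set X | S.Pairwise fun x y => τ ≤ dist x y}
    (fun c hc hchain => ⟨⋃₀ c, (Set.pairwise_sUnion hchain.directedOn).2 fun s hs => hc hs,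
      fun s hs => Set.subset_sUnion_of_mem hs⟩)
  refine ⟨S, hS.prop, fun x => ?_⟩
  by_contra! h
  have h1 : insert x S ∈ {S : Set X | S.Pairwise fun x y => τ ≤ dist x y} := by
    refine Set.Pairwise.insert hS.prop fun y hy _ => ⟨h y hy, ?_⟩
    rw [dist_comm]
    exact h y hy
  have h2 : x ∈ S := hS.le_of_ge h1 (Set.subset_insert x S) (Set.mem_insert x S)
  have := h x h2
  rw [dist_self] at this
  linarith

theorem pairwise_disjoint_ball_half {S : Set X} {τ : ℝ}
    (hS : S.Pairwise fun x y => τ ≤ dist x y) :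
    Pairwise (Function.onFun Disjoint fun i : S => ball (i : X) (τ / 2)) := fun i j hij =>
  ball_disjoint_ball (by
    have := hS i.2 j.2 (Subtype.coe_injective.ne hij)
    linarith)

theorem countable_of_separated [TopologicalSpace.SeparableSpace X] {S : Set X} {τ : ℝ} (hτ : 0 < τ)
    (hS : S.Pairwise fun x y => τ ≤ dist x y) : Countable S := by
  refine Set.PairwiseDisjoint.countable_of_isOpen (s := fun x : X => ball x (τ / 2)) ?_
    (fun _ _ => isOpen_ball) (fun x _ => nonempty_ball.2 (by linarith))
  intro x hx y hy hxy
  exact ball_disjoint_ball (by have := hS hx hy hxy; linarith)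

/-- A countable cover by measurable sets can be shrunk to a measurable partition. -/
theorem exists_measurable_partition {Y ι : Type*} [MeasurableSpace Y] [Countable ι]
    (B : ι → Set Y) (hB : ∀ i, MeasurableSet (B i)) (hcov : ⋃ i, B i = Set.univ) :
    ∃ Q : ι → Set Y, (∀ i, MeasurableSet (Q i)) ∧ (∀ i, Q i ⊆ B i) ∧
      Pairwise (Function.onFun Disjoint Q) ∧ ⋃ i, Q i = Set.univ := by
  classical
  obtain ⟨e, he⟩ := exists_injective_nat ι
  refine ⟨fun i => B i \ ⋃ j, ⋃ (_ : e j < e i), B j, fun i => (hB i).diff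
    (MeasurableSet.iUnion fun j => MeasurableSet.iUnion fun _ => hB j), fun i => Set.sdiff_subset,
    fun i j hij => ?_, ?_⟩
  · rw [Function.onFun, Set.disjoint_left]
    rintro x ⟨hxi, hxi'⟩ ⟨hxj, hxj'⟩
    simp only [Set.mem_iUnion, not_exists] at hxi' hxj'
    rcases lt_trichotomy (e i) (e j) with h | h | h
    · exact hxj' i h hxi
    · exact hij (he h)
    · exact hxi' j h hxj
  · refine Set.eq_univ_of_forall fun x => ?_
    have hx : ∃ m, ∃ i, e i = m ∧ x ∈ B i := by
      obtain ⟨i, hi⟩ := Set.mem_iUnion.1 (hcov ▸ Set.mem_univ x)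
      exact ⟨e i, i, rfl, hi⟩
    obtain ⟨i, hi, hxi⟩ := Nat.find_spec hx
    refine Set.mem_iUnion.2 ⟨i, hxi, ?_⟩
    simp only [Set.mem_iUnion, not_exists]
    intro j hj hxj
    exact Nat.find_min hx (hi ▸ hj) ⟨j, rfl, hxj⟩

end Net

section Doubling

variable {X : Type*} [MetricSpace X] [MeasurableSpace X] {μ : Measure X} {n C : ℝ}

theorem measure_ball_pos_of_doubling (hμ0 : μ ≠ 0)
    (hC : ∀ (x : X) (r s : ℝ), 0 < r → 1 ≤ s →
      μ (ball x (s * r)) ≤ ENNReal.ofReal (C * s ^ n) * μ (ball x r))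
    (x : X) {r : ℝ} (hr : 0 < r) : 0 < μ (ball x r) := by
  rw [pos_iff_ne_zero]
  intro h0
  apply hμ0
  rw [← Measure.measure_univ_eq_zero]
  have hu : (Set.univ : Set X) ⊆ ⋃ m : ℕ, ball x (((m : ℝ) + 1) * r) := fun y _ => by
    obtain ⟨m, hm⟩ := exists_nat_gt (dist y x / r)
    refine Set.mem_iUnion.2 ⟨m, ?_⟩
    rw [mem_ball]
    rw [div_lt_iff₀ hr] at hm
    nlinarith
  refine measure_mono_null hu (measure_iUnion_null fun m => ?_)
  have h1 := hC x r (m + 1) hr (by have : (0 : ℝ) ≤ m := m.cast_nonneg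
                                   linarith)
  rw [h0, mul_zero] at h1
  exact le_antisymm h1 (zero_le)

theorem measureReal_ball_le_of_doubling (hfin : ∀ (x : X) (r : ℝ), μ (ball x r) < ∞) (hC0 : 0 < C)
    (hC : ∀ (x : X) (r s : ℝ), 0 < r → 1 ≤ s →
      μ (ball x (s * r)) ≤ ENNReal.ofReal (C * s ^ n) * μ (ball x r))
    (x y : X) {r s R : ℝ} (hr : 0 < r) (hs : 1 ≤ s) (hR : R + dist x y ≤ s * r) :
    μ.real (ball x R) ≤ C * s ^ n * μ.real (ball y r) := by
  have h1 : μ (ball x R) ≤ ENNReal.ofReal (C * s ^ n) * μ (ball y r) :=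
    (measure_mono (ball_subset_ball' hR)).trans (hC y r s hr hs)
  have h2 := ENNReal.toReal_mono (ENNReal.mul_ne_top ENNReal.ofReal_ne_top (hfin y r).ne) h1
  rwa [ENNReal.toReal_mul, ENNReal.toReal_ofReal (by positivity)] at h2

/-- The half-radius balls around net points within Rτ of j are disjoint and lie in B(j, 2Rτ).
Halving the radius costs C 2^n; in the count, comparing B(j, 2Rτ) with B(i, τ) through B(i, 3Rτ)
costs C (3R)^n. This explains C² 6^n. -/
theorem isDoublingNet_of_separated [BorelSpace X] (hμ0 : μ ≠ 0)
    (hfin : ∀ (x : X) (r : ℝ), μ (ball x r) < ∞) (hn : 0 < n) (hC0 : 0 < C)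
    (hC : ∀ (x : X) (r s : ℝ), 0 < r → 1 ≤ s →
      μ (ball x (s * r)) ≤ ENNReal.ofReal (C * s ^ n) * μ (ball x r))
    {τ : ℝ} (hτ : 0 < τ) {S : Set X} (hS : S.Pairwise fun x y => τ ≤ dist x y) :
    IsDoublingNet (fun i j : S => dist (i : X) j / τ) (fun i : S => μ.real (ball (i : X) τ)) n
      (C ^ 2 * 6 ^ n) := by
  have hpos : ∀ (x : X) {r : ℝ}, 0 < r → 0 < μ.real (ball x r) := fun x r hr =>
    ENNReal.toReal_pos (measure_ball_pos_of_doubling hμ0 hC x hr).ne' (hfin x r).ne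
  have hcmp := @measureReal_ball_le_of_doubling X _ _ μ n C hfin hC0 hC
  have mass : ∀ (j : S) (R : ℝ), 1 ≤ R →
      ∑' i : S, {i : S | dist (i : X) j / τ < R}.indicator
        (fun i => ENNReal.ofReal (μ.real (ball (i : X) τ))) i
      ≤ ENNReal.ofReal (C * 2 ^ n * μ.real (ball (j : X) (2 * R * τ))) := by
    intro j R hR
    have h1 : ∀ i : S, ENNReal.ofReal (μ.real (ball (i : X) τ)) ≤
        ENNReal.ofReal (C * 2 ^ n) * μ (ball (i : X) (τ / 2)) := fun i => by
      rw [← ENNReal.ofReal_toReal (hfin i (τ / 2)).ne, ← ENNReal.ofReal_mul (by positivity)]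
      refine ENNReal.ofReal_le_ofReal (hcmp i i (by linarith) (by norm_num) ?_)
      rw [dist_self]; linarith
    rw [← tsum_subtype]
    calc _ ≤ ∑' i : {i : S | dist (i : X) j / τ < R},
          ENNReal.ofReal (C * 2 ^ n) * μ (ball ((i : S) : X) (τ / 2)) :=
          ENNReal.tsum_le_tsum fun i => h1 i
      _ ≤ ENNReal.ofReal (C * 2 ^ n) * μ (⋃ i : {i : S | dist (i : X) j / τ < R},
          ball ((i : S) : X) (τ / 2)) := by
          rw [ENNReal.tsum_mul_left]
          gcongr
          exact tsum_meas_le_meas_iUnion_of_disjoint μ (fun i => measurableSet_ball)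
            fun i i' hii => pairwise_disjoint_ball_half hS (Subtype.coe_injective.ne hii)
      _ ≤ ENNReal.ofReal (C * 2 ^ n) * μ (ball (j : X) (2 * R * τ)) := by
          gcongr
          refine Set.iUnion_subset fun i => ball_subset_ball' ?_
          have hi : dist ((i : S) : X) j / τ < R := i.2
          rw [div_lt_iff₀ hτ] at hi
          nlinarith
      _ = _ := by
          rw [ENNReal.ofReal_mul (by positivity : 0 ≤ C * (2 : ℝ) ^ n),
            ofReal_measureReal (hfin _ _).ne]
  refine ⟨fun i j => by positivity, fun i => by simp, fun i j => by rw [dist_comm],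
    fun i j k => ?_, fun i => hpos _ hτ, fun j R hR => ?_, fun j R hR => ?_⟩
  · rw [← add_div]
    gcongr
    exact dist_triangle _ _ _
  · have hm : 0 < μ.real (ball (j : X) (2 * R * τ)) := hpos _ (by positivity)
    -- Each net point counted has V_i bounded below by a fixed fraction of the mass of B(j, 2Rτ);
    -- that mass is positive and finite, hence cancels.
    have h1 : ∑' i : S, {i : S | dist (i : X) j / τ < R}.indicator (fun _ => (1 : ℝ≥0∞)) i *
        ENNReal.ofReal (μ.real (ball (j : X) (2 * R * τ))) ≤
        ENNReal.ofReal (C * (3 * R) ^ n) *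
          ENNReal.ofReal (C * 2 ^ n * μ.real (ball (j : X) (2 * R * τ))) := by
      refine le_trans (le_trans (ENNReal.tsum_le_tsum fun i => ?_) ENNReal.tsum_mul_left.le)
        (mul_le_mul_right (mass j R hR) _)
      by_cases hi : dist (i : X) j / τ < R
      · rw [Set.indicator_of_mem (by exact hi), Set.indicator_of_mem (by exact hi), one_mul,
          ← ENNReal.ofReal_mul (by positivity)]
        refine ENNReal.ofReal_le_ofReal (hcmp j i hτ (by linarith) ?_)
        rw [div_lt_iff₀ hτ, dist_comm] at hi
        nlinarith
      · rw [Set.indicator_of_notMem (by exact hi), zero_mul]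
        exact zero_le
    rw [ENNReal.tsum_mul_right, ENNReal.ofReal_mul (by positivity : 0 ≤ C * (2 : ℝ) ^ n),
      ← mul_assoc] at h1
    have h2 := (ENNReal.mul_le_mul_iff_left (by simpa using hm) ENNReal.ofReal_ne_top).1 h1
    refine h2.trans_eq ?_
    rw [← ENNReal.ofReal_mul (by positivity), Real.mul_rpow (by norm_num) (by linarith),
      show (6 : ℝ) = 3 * 2 by norm_num, Real.mul_rpow (by norm_num) (by norm_num)]
    congr 1; ring
  · refine (mass j R hR).trans (ENNReal.ofReal_le_ofReal ?_)
    have h1 : μ.real (ball (j : X) (2 * R * τ)) ≤ C * (2 * R) ^ n * μ.real (ball (j : X) τ) :=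
      hcmp j j hτ (by linarith) (by rw [dist_self, add_zero])
    have h2 : (2 : ℝ) ^ n ≤ 3 ^ n := by gcongr; norm_num
    have hR0 : 0 < R := by linarith
    calc _ ≤ C * 3 ^ n * (C * (2 * R) ^ n * μ.real (ball (j : X) τ)) := by gcongr
      _ = _ := by
        rw [Real.mul_rpow (by norm_num) hR0.le, show (6 : ℝ) = 3 * 2 by norm_num,
          Real.mul_rpow (by norm_num) (by norm_num)]
        ring

end Doubling

/-! ### The blocks of L² cut out by a measurable partition. -/

section Blocks

variable {X : Type*} [MeasurableSpace X] {μ : Measure X}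

/-- Multiplication by the indicator function of a measurable set, as an operator on `L²`. -/
noncomputable def indicatorL2 {s : Set X} (hs : MeasurableSet s) : Lp ℂ 2 μ →L[ℂ] Lp ℂ 2 μ :=
  LinearMap.mkContinuous
    { toFun := fun f => ((Lp.memLp f).indicator hs).toLp
      map_add' := fun f g => by
        rw [← MemLp.toLp_add]
        refine (MemLp.toLp_eq_toLp_iff _ _).2 ?_
        filter_upwards [Lp.coeFn_add f g] with x hx
        simp only [Set.indicator, Pi.add_apply] at hx ⊢
        split_ifs
        · exact hx
        · simp
      map_smul' := fun c f => by
        rw [RingHom.id_apply, ← MemLp.toLp_const_smul]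
        refine (MemLp.toLp_eq_toLp_iff _ _).2 ?_
        filter_upwards [Lp.coeFn_smul c f] with x hx
        simp only [Set.indicator, Pi.smul_apply] at hx ⊢
        split_ifs
        · exact hx
        · simp } 1 fun f => by
    rw [one_mul]
    refine Lp.norm_le_norm_of_ae_le ?_
    filter_upwards [((Lp.memLp f).indicator hs).coeFn_toLp] with x hx
    simp only [LinearMap.coe_mk, AddHom.coe_mk, hx]
    exact norm_indicator_le_norm_self _ _

theorem coeFn_indicatorL2 {s : Set X} (hs : MeasurableSet s) (f : Lp ℂ 2 μ) :
    indicatorL2 hs f =ᵐ[μ] s.indicator f :=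
  ((Lp.memLp f).indicator hs).coeFn_toLp

theorem eLpNorm_rpow_eq_tsum {E ι : Type*} [NormedAddCommGroup E] [Countable ι] {Q : ι → Set X}
    (hQ : ∀ i, MeasurableSet (Q i)) (hd : Pairwise (Function.onFun Disjoint Q))
    (hu : ⋃ i, Q i = Set.univ) (p : ℝ) (hp : 0 < p) (f : X → E) :
    eLpNorm f (ENNReal.ofReal p) μ ^ p =
      ∑' i, eLpNorm ((Q i).indicator f) (ENNReal.ofReal p) μ ^ p := by
  have e : ∀ ν : Measure X, eLpNorm f (ENNReal.ofReal p) ν ^ p = ∫⁻ x, ‖f x‖ₑ ^ p ∂ν := fun ν => by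
    rw [eLpNorm_eq_lintegral_rpow_enorm_toReal (by simpa using hp) ENNReal.ofReal_ne_top,
      ENNReal.toReal_ofReal hp.le, ← ENNReal.rpow_mul, one_div, inv_mul_cancel₀ hp.ne',
      ENNReal.rpow_one]
  simp_rw [fun i => eLpNorm_indicator_eq_eLpNorm_restrict (f := f) (p := ENNReal.ofReal p)
    (μ := μ) (hQ i), e]
  rw [← lintegral_iUnion hQ hd, hu, Measure.restrict_univ]

theorem isBlockDecomposition_indicatorL2 {ι : Type*} [Countable ι] {Q : ι → Set X}
    (hQ : ∀ i, MeasurableSet (Q i)) (hd : Pairwise (Function.onFun Disjoint Q))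
    (hu : ⋃ i, Q i = Set.univ) :
    IsBlockDecomposition fun i => indicatorL2 (μ := μ) (hQ i) := by
  classical
  have hsq : ∀ f : Lp ℂ 2 μ, ‖f‖ₑ ^ (2 : ℝ) = ∑' i, ‖indicatorL2 (hQ i) f‖ₑ ^ (2 : ℝ) := fun f => by
    have h := eLpNorm_rpow_eq_tsum (μ := μ) hQ hd hu 2 two_pos f
    simp only [ENNReal.ofReal_ofNat] at h
    simp only [Lp.enorm_def, h]
    exact tsum_congr fun i => by rw [eLpNorm_congr_ae (coeFn_indicatorL2 (hQ i) f)]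
  have hself : ∀ i (f : Lp ℂ 2 μ),
      indicatorL2 (hQ i) (indicatorL2 (hQ i) f) = indicatorL2 (hQ i) f := fun i f => by
    refine Lp.ext ?_
    filter_upwards [coeFn_indicatorL2 (hQ i) (indicatorL2 (hQ i) f), coeFn_indicatorL2 (hQ i) f]
      with x h1 h2
    rw [h1, h2]
    by_cases hx : x ∈ Q i <;> simp [hx, h2]
  have hne : ∀ i j, i ≠ j → ∀ f : Lp ℂ 2 μ, indicatorL2 (hQ i) (indicatorL2 (hQ j) f) = 0 := by
    intro i j hij f
    refine Lp.ext ?_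
    filter_upwards [coeFn_indicatorL2 (hQ i) (indicatorL2 (hQ j) f), coeFn_indicatorL2 (hQ j) f,
      Lp.coeFn_zero ℂ 2 μ] with x h1 h2 h3
    rw [h1, h3]
    by_cases hx : x ∈ Q i
    · have : x ∉ Q j := Set.disjoint_left.1 (hd hij) hx
      simp [hx, h2, this]
    · simp [hx]
  refine ⟨hself, hne, fun i f g => ?_, fun f => ?_⟩
  · rw [L2.inner_def, L2.inner_def]
    refine integral_congr_ae ?_
    filter_upwards [coeFn_indicatorL2 (hQ i) f, coeFn_indicatorL2 (hQ i) g] with x h1 h2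
    rw [h1, h2]
    by_cases hx : x ∈ Q i <;> simp [hx]
  -- By Parseval, the squared remainder is the tail of a convergent series.
  · have hrem : ∀ F : Finset ι, ‖∑ i ∈ F, indicatorL2 (hQ i) f - f‖ₑ ^ (2 : ℝ) =
        ∑' i : {i // i ∉ F}, ‖indicatorL2 (hQ i) f‖ₑ ^ (2 : ℝ) := fun F => by
      rw [hsq]
      have : ∀ i, ‖indicatorL2 (hQ i) (∑ j ∈ F, indicatorL2 (hQ j) f - f)‖ₑ ^ (2 : ℝ) =
          {i | i ∉ F}.indicator (fun i => ‖indicatorL2 (hQ i) f‖ₑ ^ (2 : ℝ)) i := fun i => by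
        have h0 : indicatorL2 (hQ i) (∑ j ∈ F, indicatorL2 (hQ j) f) =
            if i ∈ F then indicatorL2 (hQ i) f else 0 := by
          rw [map_sum, ← Finset.sum_ite_eq F i fun j => indicatorL2 (hQ j) f]
          refine Finset.sum_congr rfl fun j _ => ?_
          split_ifs with h
          · subst h; rw [hself]
          · exact hne i j h f
        rw [map_sub, h0]
        by_cases hi : i ∈ F <;> simp [hi]
      simp_rw [this]
      exact (tsum_subtype {i | i ∉ F} _).symm
    have hlim : Filter.Tendsto (fun F : Finset ι =>
        ‖∑ i ∈ F, indicatorL2 (hQ i) f - f‖ₑ ^ (2 : ℝ)) Filter.atTop (nhds 0) := by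
      simp_rw [hrem]
      refine ENNReal.tendsto_tsum_compl_atTop_zero
        (f := fun i => ‖indicatorL2 (hQ i) f‖ₑ ^ (2 : ℝ)) ?_
      rw [← hsq]
      exact ENNReal.rpow_ne_top_of_nonneg zero_le_two enorm_ne_top
    have h2 := hlim.ennrpow_const (1 / 2)
    simp only [← ENNReal.rpow_mul] at h2
    norm_num at h2
    exact tendsto_iff_enorm_sub_tendsto_zero.2 h2

end Blocks

/-! ### The off-diagonal condition on blocks. -/

section OffDiagonal

variable {X : Type*} [MeasurableSpace X] {μ : Measure X}

theorem eLpNorm_indicator_le_rpow_mul {s t : Set X} (hs : MeasurableSet s) (hst : s ⊆ t)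
    (ht : μ t < ∞) {p : ℝ} (hp1 : 1 ≤ p) (hp2 : p < 2) (f : Lp ℂ 2 μ) :
    eLpNorm (s.indicator f) (ENNReal.ofReal p) μ ≤
      ENNReal.ofReal (μ.real t ^ sigmaExp p) * ‖indicatorL2 hs f‖ₑ := by
  have hσ : 0 ≤ sigmaExp p := by
    have := one_div_le_one_div_of_le (by linarith : 0 < p) hp2.le
    simp only [sigmaExp]; linarith
  have hpe : ENNReal.ofReal p ≤ 2 := by
    rw [← ENNReal.ofReal_ofNat]; exact ENNReal.ofReal_le_ofReal hp2.le
  rw [Lp.enorm_def, eLpNorm_congr_ae (coeFn_indicatorL2 hs f),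
    eLpNorm_indicator_eq_eLpNorm_restrict hs, eLpNorm_indicator_eq_eLpNorm_restrict hs]
  refine (eLpNorm_le_eLpNorm_mul_rpow_measure_univ hpe
    (Lp.aestronglyMeasurable f).restrict).trans ?_
  rw [mul_comm, ENNReal.toReal_ofReal (by linarith), Measure.restrict_apply_univ,
    ENNReal.toReal_ofNat]
  gcongr
  rw [← ENNReal.ofReal_rpow_of_nonneg measureReal_nonneg hσ, ofReal_measureReal ht.ne]
  exact ENNReal.rpow_le_rpow (measure_mono hst) hσ

/-- The strict inequality provides an admissible constant below c, so attainment of the infimum is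
not needed. -/
theorem eLpNorm_le_of_opNormLp_lt {p q : ℝ≥0∞} {T : Lp ℂ 2 μ → X → ℂ} {c : ℝ≥0∞}
    (h : opNormLp p q T < c) (f : Lp ℂ 2 μ) (hf : MemLp f p μ) :
    eLpNorm (T f) q μ ≤ c * eLpNorm f p μ := by
  obtain ⟨c', hc', hlt⟩ := sInf_lt_iff.1 h
  exact (hc' f hf).trans (mul_le_mul_left hlt.le _)

variable [MetricSpace X] [BorelSpace X]

/-- The off-diagonal condition, read on subsets of balls. -/
theorem enorm_indicator_le_of_opNormLp_lt {n C : ℝ}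
    (hfin : ∀ (x : X) (r : ℝ), μ (ball x r) < ∞) (hC0 : 0 < C)
    (hC : ∀ (x : X) (r s : ℝ), 0 < r → 1 ≤ s →
      μ (ball x (s * r)) ≤ ENNReal.ofReal (C * s ^ n) * μ (ball x r))
    {p : ℝ} (hp1 : 1 ≤ p) (hp2 : p < 2) {τ : ℝ} (hτ : 0 < τ) (A : Lp ℂ 2 μ →L[ℂ] Lp ℂ 2 μ)
    {x y : X} {c : ℝ}
    (hc : opNormLp (ENNReal.ofReal p) 2 (offDiagPiece A (sigmaExp p) τ x y) < ENNReal.ofReal c)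
    {s t : Set X} (hs : MeasurableSet s) (ht : MeasurableSet t) (hsx : s ⊆ ball x τ)
    (hty : t ⊆ ball y τ) (f : Lp ℂ 2 μ) :
    ENNReal.ofReal (μ.real (ball x τ) ^ sigmaExp p) *
        ‖indicatorL2 hs (A (indicatorL2 ht f))‖ₑ ≤
      ENNReal.ofReal ((C * 2 ^ n) ^ sigmaExp p * c) *
        eLpNorm (t.indicator f) (ENNReal.ofReal p) μ := by
  have hσ : 0 ≤ sigmaExp p := by
    have := one_div_le_one_div_of_le (by linarith : 0 < p) hp2.le
    simp only [sigmaExp]; linarith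
  have hcoe := coeFn_indicatorL2 ht f
  have hmem : MemLp (indicatorL2 ht f) (ENNReal.ofReal p) μ := by
    refine ⟨Lp.aestronglyMeasurable _, ?_⟩
    rw [eLpNorm_congr_ae hcoe]
    exact (eLpNorm_indicator_le_rpow_mul ht hty (hfin y τ) hp1 hp2 f).trans_lt
      (ENNReal.mul_lt_top ENNReal.ofReal_lt_top enorm_lt_top)
  have hball : ballProj y τ (indicatorL2 ht f) = indicatorL2 ht f := by
    refine Lp.ext ?_
    filter_upwards [((Lp.memLp (indicatorL2 ht f)).indicator
      (measurableSet_ball (x := y) (ε := τ))).coeFn_toLp, hcoe] with z h1 h2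
    rw [ballProj, h1]
    by_cases hz : z ∈ ball y τ
    · rw [Set.indicator_of_mem hz]
    · rw [Set.indicator_of_notMem hz, h2, Set.indicator_of_notMem fun h => hz (hty h)]
  have h1 := eLpNorm_le_of_opNormLp_lt hc _ hmem
  rw [eLpNorm_congr_ae hcoe] at h1
  set u := A (indicatorL2 ht f) with hu
  set v : ℝ := μ.real (ball x τ) ^ sigmaExp p
  have hv : 0 ≤ v := by positivity
  -- For z in B(x, τ) one has B(x, τ) ⊆ B(z, 2τ), so this factor replaces V(z, τ)^σ by the constant
  -- V(x, τ)^σ.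
  set K : ℝ := (C * 2 ^ n) ^ sigmaExp p
  have hK : 0 ≤ K := by positivity
  have h2 : ENNReal.ofReal v * ‖indicatorL2 hs u‖ₑ ≤ ENNReal.ofReal K *
      eLpNorm (offDiagPiece A (sigmaExp p) τ x y (indicatorL2 ht f)) 2 μ := by
    rw [Lp.enorm_def, eLpNorm_congr_ae (coeFn_indicatorL2 hs u)]
    have e : ∀ (r : ℝ) (g : X → ℂ), 0 ≤ r →
        ENNReal.ofReal r * eLpNorm g 2 μ = eLpNorm ((r : ℂ) • g) 2 μ := fun r g hr => by
      rw [eLpNorm_const_smul, ← ofReal_norm, Complex.norm_real, Real.norm_of_nonneg hr]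
    rw [e v _ hv, e K _ hK]
    refine eLpNorm_mono fun z => ?_
    simp only [Pi.smul_apply, offDiagPiece, hball, ← hu]
    by_cases hz : z ∈ s
    · have hzx := hsx hz
      rw [Set.indicator_of_mem hz, Set.indicator_of_mem hzx, smul_eq_mul, smul_eq_mul, norm_mul,
        norm_mul, norm_mul, Complex.norm_real, Complex.norm_real, Complex.norm_real,
        Real.norm_of_nonneg hv, Real.norm_of_nonneg hK, Real.norm_of_nonneg (by positivity),
        ← mul_assoc]
      gcongr
      rw [← Real.mul_rpow (by positivity) measureReal_nonneg]
      refine Real.rpow_le_rpow measureReal_nonneg ?_ hσ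
      refine measureReal_ball_le_of_doubling hfin hC0 hC x z hτ (by norm_num) ?_
      rw [mem_ball, dist_comm] at hzx
      linarith
    · rw [Set.indicator_of_notMem hz, smul_zero, norm_zero]
      positivity
  refine h2.trans ?_
  rw [ENNReal.ofReal_mul hK, mul_assoc]
  gcongr

end OffDiagonal

/-- An off-diagonal estimate between differently weighted blocks becomes unweighted for a
self-adjoint operator. -/
theorem IsBlockDecomposition.norm_le_of_weighted {H ι : Type*} [NormedAddCommGroup H]
    [InnerProductSpace ℂ H] [CompleteSpace H] {P : ι → H →L[ℂ] H} (hP : IsBlockDecomposition P)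
    {A : H →L[ℂ] H} (hA : IsSelfAdjoint A) {v : ι → ℝ} (hv : ∀ i, 0 < v i) {k : ι → ι → ℝ}
    (hk0 : ∀ i j, 0 ≤ k i j) (hks : ∀ i j, k i j = k j i)
    (h : ∀ i j y, v i * ‖P i (A (P j y))‖ ≤ k i j * (v j * ‖P j y‖)) (i j : ι) (y : H) :
    ‖P i (A (P j y))‖ ≤ k i j * ‖P j y‖ := by
  -- When v j ≤ v i the weights help; in the other case the adjoint block, with i and j exchanged,
  -- has the same norm.
  have key : ∀ i j y, v j ≤ v i → ‖P i (A (P j y))‖ ≤ k i j * ‖P j y‖ := fun i j y hij => by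
    refine le_of_mul_le_mul_left ((h i j y).trans ?_) (hv i)
    rw [mul_left_comm]
    have := hk0 i j
    gcongr
  rcases le_total (v j) (v i) with hij | hij
  · exact key i j y hij
  · set z := P i (A (P j y))
    have hAs : ∀ x x', inner ℂ (A x) x' = inner ℂ x (A x') := fun x x' => by
      rw [← ContinuousLinearMap.adjoint_inner_left, hA.adjoint_eq]
    have h1 : inner ℂ z z = inner ℂ (P j y) (P j (A (P i z))) :=
      (hP.inner_proj i (A (P j y)) z).trans (by
        rw [hAs, ← hP.inner_proj j (P j y), hP.proj_self j y])
    have h2 : ‖z‖ ^ 2 ≤ ‖P j y‖ * ‖P j (A (P i z))‖ := by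
      have h3 := norm_inner_le_norm (𝕜 := ℂ) (P j y) (P j (A (P i z)))
      rwa [← h1, inner_self_eq_norm_sq_to_K, norm_pow, RCLike.norm_ofReal, abs_norm] at h3
    have h3 := key j i z hij
    have h4 : P i z = z := hP.proj_self i _
    rw [h4] at h2 h3
    rcases (norm_nonneg z).eq_or_lt with h0 | h0
    · rw [← h0]
      have := hk0 i j
      positivity
    · refine le_of_mul_le_mul_left ?_ h0
      calc ‖z‖ * ‖z‖ = ‖z‖ ^ 2 := by ring
        _ ≤ ‖P j y‖ * (k j i * ‖z‖) := h2.trans (by gcongr)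
        _ = _ := by rw [hks j i]; ring

/-! ### Assembly of the estimate. -/

theorem theorem3p4 {X : Type*} [MetricSpace X] [TopologicalSpace.SeparableSpace X]
    [MeasurableSpace X] [BorelSpace X] (μ : Measure X)
    (n : ℝ) (hn : 0 < n) (hμ : IsDoublingWithDim μ n)
    (p : ℝ) (hp1 : 1 ≤ p) (hp2 : p < 2)
    (a : ℝ) (ha : (⌊n / 2⌋ : ℝ) + 1 < a)
    (τ : ℝ) (hτ : 0 < τ)
    (A : Lp ℂ 2 μ →L[ℂ] Lp ℂ 2 μ) (hA : IsSelfAdjoint A) (hPVE : PVE n a p τ A) :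
    ∃ C : ℝ, 0 < C ∧ ∀ t : ℝ,
      opNormLp (ENNReal.ofReal p) (ENNReal.ofReal p)
          (fun f : Lp ℂ 2 μ => (NormedSpace.exp ((Complex.I * (t : ℂ)) • A) (A f) : X → ℂ))
        ≤ ENNReal.ofReal (C * (1 + |t|) ^ (n * sigmaExp p)) := by
  -- If μ ≠ 0, doubling makes every ball of positive radius have positive measure, as the weights
  -- V_i require.
  rcases eq_or_ne μ 0 with hμ0 | hμ0
  · subst hμ0
    exact ⟨1, one_pos, fun t => sInf_le fun f _ => by simp⟩
  obtain ⟨hfin, C₀, hC0, hC⟩ := hμ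
  obtain ⟨C₁, hC1, hA1⟩ := hPVE
  have hp0 : 0 < p := by linarith
  obtain ⟨S, hS, hcov⟩ := exists_separated_net (X := X) τ hτ
  have : Countable S := countable_of_separated hτ hS
  obtain ⟨Q, hQ, hQB, hQd, hQu⟩ := exists_measurable_partition
    (fun i : S => ball (i : X) τ) (fun i => measurableSet_ball)
    (Set.eq_univ_of_forall fun x => by
      obtain ⟨y, hy, hxy⟩ := hcov x
      exact Set.mem_iUnion.2 ⟨⟨y, hy⟩, hxy⟩)
  set P : S → Lp ℂ 2 μ →L[ℂ] Lp ℂ 2 μ := fun i => indicatorL2 (hQ i)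
  have hP : IsBlockDecomposition P := isBlockDecomposition_indicatorL2 hQ hQd hQu
  set ρ : S → S → ℝ := fun i j => dist (i : X) j / τ
  set V : S → ℝ := fun i => μ.real (ball (i : X) τ)
  have hρ : IsDoublingNet ρ V n (C₀ ^ 2 * 6 ^ n) :=
    isDoublingNet_of_separated hμ0 hfin hn hC0 hC hτ hS
  have hCn : 0 < C₀ ^ 2 * (6 : ℝ) ^ n := by positivity
  have hρ1 : ∀ i j, 0 < 1 + ρ i j := fun i j => by linarith [hρ.nonneg i j]
  set c : ℝ := (C₀ * 2 ^ n) ^ sigmaExp p * C₁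
  have hc : 0 < c := by positivity
  -- off-diagonal bounds from `L^p` to `L²` and on `L²`
  have hLp : ∀ i j f, ENNReal.ofReal (V i ^ sigmaExp p) * ‖P i (A (P j f))‖ₑ ≤
      ENNReal.ofReal (c * (1 + ρ i j) ^ (-(n + a))) *
        eLpNorm ((Q j).indicator f) (ENNReal.ofReal p) μ := fun i j f => by
    have h := enorm_indicator_le_of_opNormLp_lt hfin hC0 hC hp1 hp2 hτ A (hA1 i j) (hQ i) (hQ j)
      (hQB i) (hQB j) f
    rwa [← mul_assoc, show -n - a = -(n + a) by ring] at h
  have hVσ : ∀ i, 0 < V i ^ sigmaExp p := fun i => Real.rpow_pos_of_pos (hρ.pos i) _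
  have hk0 : ∀ i j, 0 ≤ c * (1 + ρ i j) ^ (-(n + a)) := fun i j => by
    have := hρ1 i j
    positivity
  have hL2 : ∀ i j y, ‖P i (A (P j y))‖ ≤ c * (1 + ρ i j) ^ (-(n + a)) * ‖P j y‖ := by
    refine hP.norm_le_of_weighted hA hVσ hk0 (fun i j => by rw [hρ.symm]) fun i j y => ?_
    have h := (hLp i j y).trans (mul_le_mul_right
      (eLpNorm_indicator_le_rpow_mul (hQ j) (hQB j) (hfin j τ) hp1 hp2 y) _)
    have hVi := (hVσ i).le
    have hVj := (hVσ j).le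
    rw [← ofReal_norm, ← ofReal_norm, ← ENNReal.ofReal_mul hVi] at h
    change _ ≤ _ * (ENNReal.ofReal (V j ^ sigmaExp p) * _) at h
    rw [← ENNReal.ofReal_mul hVj, ← ENNReal.ofReal_mul (hk0 i j)] at h
    exact (ENNReal.ofReal_le_ofReal_iff
      (mul_nonneg (hk0 i j) (mul_nonneg hVj (norm_nonneg _)))).1 h
  -- the group on weighted `ℓ^p` sums
  have hfl : 0 ≤ ⌊n / 2⌋ := Int.floor_nonneg.2 (by positivity)
  -- This k is the least integer with 2k > n, and a > k is exactly the condition n < (n + a) - k for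
  -- a summable commutator kernel.
  obtain ⟨k, hk⟩ : ∃ k : ℕ, (k : ℝ) = (⌊n / 2⌋ : ℝ) + 1 :=
    ⟨⌊n / 2⌋.toNat + 1, by
      have : ((⌊n / 2⌋.toNat : ℤ) : ℝ) = (⌊n / 2⌋ : ℝ) := by rw [Int.toNat_of_nonneg hfl]
      push_cast at this ⊢
      rw [this]⟩
  obtain ⟨D, hD, hDb⟩ := hP.exists_tsum_expGroup_rpow_le hCn hn hρ A hA (n + a) c hc.le hL2 k
    (by linarith) (by linarith [Int.lt_floor_add_one (n / 2)]) p hp1 hp2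
  have ha0 : n < n + a := by
    have : (0 : ℝ) ≤ ⌊n / 2⌋ := by exact_mod_cast hfl
    linarith
  obtain ⟨K, hK, hKb⟩ := hρ.exists_tsum_rpow_neg_le hCn hn (n + a) ha0
  refine ⟨D ^ (1 / p) * (c * K), by positivity, fun t => sInf_le fun f hf => ?_⟩
  change eLpNorm (expGroup A t (A f)) _ _ ≤ _
  -- The factor A in e^{itA}A carries L^p into the block space; the decay order n + a > n makes the
  -- kernel a Schur kernel.
  have hschur : ∑' i, (ENNReal.ofReal (V i ^ sigmaExp p) * ‖P i (A f)‖ₑ) ^ p ≤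
      ENNReal.ofReal (c * K) ^ p * eLpNorm f (ENNReal.ofReal p) μ ^ p := by
    have hcol : ∀ j, ∑' i, ENNReal.ofReal (c * (1 + ρ i j) ^ (-(n + a))) ≤
        ENNReal.ofReal (c * K) := fun j => by
      simp_rw [ENNReal.ofReal_mul hc.le]
      rw [ENNReal.tsum_mul_left]
      gcongr
      exact hKb j
    rw [eLpNorm_rpow_eq_tsum hQ hQd hQu p hp0]
    refine ENNReal.tsum_rpow_le_of_schur p hp1
      (fun i j => ENNReal.ofReal (c * (1 + ρ i j) ^ (-(n + a)))) _
      (fun i => by simpa only [hρ.symm i] using hcol i) hcol _ _ fun i => ?_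
    have hs : HasSum (fun j => P i (A (P j f))) (P i (A f)) := ((hP.hasSum f).mapL A).mapL (P i)
    calc _ ≤ ENNReal.ofReal (V i ^ sigmaExp p) * ∑' j, ‖P i (A (P j f))‖ₑ := by
          gcongr
          exact IsBlockDecomposition.enorm_le_tsum_of_hasSum hs
      _ ≤ _ := by
          rw [← ENNReal.tsum_mul_left]
          exact ENNReal.tsum_le_tsum fun j => hLp i j f
  have hfinal : eLpNorm (expGroup A t (A f)) (ENNReal.ofReal p) μ ^ p ≤
      (ENNReal.ofReal (D ^ (1 / p) * (c * K) * (1 + |t|) ^ (n * sigmaExp p)) *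
        eLpNorm f (ENNReal.ofReal p) μ) ^ p := by
    rw [eLpNorm_rpow_eq_tsum hQ hQd hQu p hp0]
    calc _ ≤ ∑' i, (ENNReal.ofReal (V i ^ sigmaExp p) * ‖P i (expGroup A t (A f))‖ₑ) ^ p := by
          gcongr with i
          exact eLpNorm_indicator_le_rpow_mul (hQ i) (hQB i) (hfin i τ) hp1 hp2 _
      _ ≤ _ := hDb t (A f)
      _ ≤ ENNReal.ofReal (D * ((1 + |t|) ^ (n * sigmaExp p)) ^ p) *
          (ENNReal.ofReal (c * K) ^ p * eLpNorm f (ENNReal.ofReal p) μ ^ p) := by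
          exact mul_le_mul_right hschur _
      _ = _ := by
          have hcK : 0 ≤ c * K := by positivity
          generalize c * K = L at hcK ⊢
          rw [ENNReal.mul_rpow_of_nonneg _ _ hp0.le, ← mul_assoc,
            ENNReal.ofReal_rpow_of_nonneg hcK hp0.le, ← ENNReal.ofReal_mul (by positivity),
            ENNReal.ofReal_rpow_of_nonneg (by positivity) hp0.le,
            Real.mul_rpow (by positivity) (by positivity), Real.mul_rpow (by positivity) hcK,
            ← Real.rpow_mul hD.le, one_div, inv_mul_cancel₀ hp0.ne', Real.rpow_one]
          congr 2; ring
  exact (ENNReal.rpow_le_rpow_iff hp0).1 hfinal
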